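/- Let $\Psi$ be a finite non-empty set of $G=|\Psi|$ user groups, with $Q\ge 1$ served users $(\psi,k)$, $k\in[Q]$, in each group $\psi\in\Psi$. User $(\psi,k)$ has $M_{\psi,k}\ge 1$ receive antennas; put $M_\psi=\sum_{k}M_{\psi,k}$. Let $N_0,P_{\rm tot},\beta_{\psi,k}>0$, and let $\xi=\xi_{G,Q}=1-\Theta\big(\sum_{\psi,k}M_{\psi,k}\big)/T>0$, where $T>0$ is the length of the coherence block and $\Theta\ge 0$ the number of pilot symbols per receive antenna and block. For each number $L$ of transmit antennas let ${\bf H}_{\psi,k}\in\mathbb C^{L\times M_{\psi,k}}$ be random matrices (independent Rayleigh fading) with jointly independent entries, those of ${\bf H}_{\psi,k}$ having the circularly symmetric complex Gaussian law $\mathcal{CN}(0,\beta_{\psi,k})$; all of them live on one probability space, with arbitrary dependence between different $L$. All parameters except $L$ are fixed. Let ${\bf H}_{\psi,-k}$ consist of the columns of all ${\bf H}_{\psi,j}$ with $j\ne k$, and let ${\bf T}_{\psi,-k}={\bf I}_L-{\bf H}_{\psi,-k}^*({\bf H}_{\psi,-k}^T{\bf H}_{\psi,-k}^*)^{-1}{\bf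 H}_{\psi,-k}^T$, where ${}^*$ is the entrywise complex conjugate. In the BD-MRC scheme with $M_{\psi,k}$ streams per user, stream $q$ of user $(\psi,k)$ uses the precoder ${\bf v}_{\psi,k,q}={\bf T}_{\psi,-k}{\bf m}_{\psi,k,q}/\|{\bf T}_{\psi,-k}{\bf m}_{\psi,k,q}\|$, where ${\bf m}_{\psi,k,1},\dots,{\bf m}_{\psi,k,M_{\psi,k}}$ are orthogonal eigenvectors of ${\bf T}_{\psi,-k}{\bf H}_{\psi,k}^*{\bf H}_{\psi,k}^T{\bf T}_{\psi,-k}$ for nonzero eigenvalues, and the combiner ${\bf r}_{\psi,k,q}={\bf H}_{\psi,k}^T{\bf v}_{\psi,k,q}/\|{\bf H}_{\psi,k}^T{\bf v}_{\psi,k,q}\|$. For powers $P_{\psi,k,q}\ge 0$ its SINR is $P_{\psi,k,q}|{\bf r}_{\psi,k,q}^H{\bf H}_{\psi,k}^T{\bf v}_{\psi,k,q}|^2$ divided by $N_0+\sum_{(j,p)\neq(k,q)}P_{\psi,j,p}|{\bf r}_{\psi,k,q}^H{\bf H}_{\psi,k}^T{\bf v}_{\psi,j,p}|^2$, and the rate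 of user $(\psi,k)$ is $R_{\psi,k}=\xi\sum_q\ln(1+{\rm SINR}_{\psi,k,q})$. A power allocation is MMF-optimal if it maximizes $\min_{\psi,k}R_{\psi,k}$ among all allocations with $P_{\psi,k,q}\ge0$ and $\sum_{\psi,k,q}P_{\psi,k,q}\le P_{\rm tot}$; $R^\star=\sum_{\psi,k}R_{\psi,k}$ denotes the sum-rate at such an optimum. For every $L$ with $L>M_\psi-M_{\psi,k}$ for all $\psi,k$, the equation $$\sum_{\psi\in\Psi}\sum_{k\in[Q]}\frac{N_0M_{\psi,k}\Big(\exp\big(\tfrac{\mathring R}{\xi M_{\psi,k}GQ}\big)-1\Big)}{\beta_{\psi,k}(L-M_\psi+M_{\psi,k})}=P_{\rm tot}$$ has exactly one real solution $\mathring R=\mathring R_L$; put $$\mathring P_{\psi,k,q}=\frac{N_0\Big(\exp\big(\tfrac{\mathring R}{\xi M_{\psi,k}GQ}\big)-1\Big)}{\beta_{\psi,k}(L-M_\psi+M_{\psi,k})}\qquad(q\in[M_{\psi,k}]).$$ Then almost surely, as $L\to\infty$ (with $\simeq$ meaning that the ratio tends to $1$): 1. Every eigenvalue $\lambda_{\psi,k,q}$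 of ${\bf H}_{\psi,k}^T{\bf T}_{\psi,-k}{\bf H}_{\psi,k}^*$ satisfies $\lambda_{\psi,k,q}\simeq\beta_{\psi,k}(L-M_\psi+M_{\psi,k})$. For all large $L$ these matrices have full rank $M_{\psi,k}$, and a BD-MRC scheme as above and, for each such scheme, an MMF-optimal allocation exist. 2. For every choice of BD-MRC schemes and of MMF-optimal allocations, $R^\star-\mathring R\to0$ and $R^\star\simeq\mathring R$. 3. For all large $L$ the equal-per-stream allocation $\mathring P$ is feasible with total power exactly $P_{\rm tot}$. It is asymptotically optimal: under it $R_{\psi,k}-\mathring R/(GQ)\to0$ for each user, and the difference between the optimal minimum rate and its minimum rate tends to $0$. Moreover, each MMF-optimal allocation satisfies $P_{\psi,k,q}\simeq\mathring P_{\psi,k,q}$ for all $\psi,k,q$. 4. If $M_{\psi,k}=M$ for all $\psi,k$, then $\mathring R=\xi GQM\ln\Big(1+\frac{P_{\rm tot}(L-(Q-1)M)}{N_0M\sum_{\psi,k}\beta_{\psi,k}^{-1}}\Big)$; hence $R^\star$ is $\simeq$ this expression, and the difference of the two tends to $0$. -/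

import Mathlib

open MeasureTheory ProbabilityTheory Filter Topology Matrix
open scoped NNReal

noncomputable section

namespace VCC

/-- The circularly symmetric complex Gaussian law `CN(0, v)`: independent real and imaginary
parts, each of law `N(0, v / 2)`. -/
def complexGaussian (v : ℝ) : Measure ℂ :=
  ((gaussianReal 0 (v / 2).toNNReal).prod (gaussianReal 0 (v / 2).toNNReal)).map
    Complex.measurableEquivRealProd.symm

section Model

variable {Ψ : Type*} {Q : ℕ} {M : Ψ → Fin Q → ℕ}

/-- One channel realization with `L` transmit antennas: for every user `(ψ, k)` the
`L × M ψ k` channel matrix. -/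
abbrev Channel (L : ℕ) (M : Ψ → Fin Q → ℕ) : Type _ :=
  ∀ (ψ : Ψ) (k : Fin Q), Matrix (Fin L) (Fin (M ψ k)) ℂ

/-- A power allocation: one real number per user and stream. -/
abbrev Powers (M : Ψ → Fin Q → ℕ) : Type _ :=
  ∀ (ψ : Ψ) (k : Fin Q), Fin (M ψ k) → ℝ

/-- For every user `(ψ, k)` and every stream of this user a vector in `ℂ ^ L`. -/
abbrev Directions (L : ℕ) (M : Ψ → Fin Q → ℕ) : Type _ :=
  ∀ (ψ : Ψ) (k : Fin Q), Fin (M ψ k) → Fin L → ℂ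

/-- Independent Rayleigh fading: all entries of all channel matrices are jointly independent, and
those of user `(ψ, k)` have law `CN(0, β ψ k)`. -/
structure IsRayleigh {Ω : Type*} [MeasurableSpace Ω] (μ : Measure Ω) {L : ℕ}
    (β : Ψ → Fin Q → ℝ) (H : Ω → Channel L M) : Prop where
  law : ∀ (ψ : Ψ) (k : Fin Q) (i : Fin L) (j : Fin (M ψ k)),
    HasLaw (fun ω => H ω ψ k i j) (complexGaussian (β ψ k)) μ
  indep : iIndepFun
    (fun (e : Σ u : Ψ × Fin Q, Fin L × Fin (M u.1 u.2)) (ω : Ω) =>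
      H ω e.1.1 e.1.2 e.2.1 e.2.2) μ

/-- The total number of receive antennas of the served users of group `ψ`. -/
def groupAntennas (M : Ψ → Fin Q → ℕ) (ψ : Ψ) : ℕ := ∑ k, M ψ k

/-- The fraction `1 - Θ (∑ M) / T` of a coherence block of `T` symbols that is left after pilot
transmission with `Θ` symbols per receive antenna. -/
def csiFactor [Fintype Ψ] (M : Ψ → Fin Q → ℕ) (Θ T : ℝ) : ℝ :=
  1 - Θ * (∑ ψ, ∑ k, (M ψ k : ℝ)) / T

/-- The number `G Q` of simultaneously served users. -/
def numUsers (Ψ : Type*) [Fintype Ψ] (Q : ℕ) : ℝ := (Fintype.card Ψ : ℝ) * (Q : ℝ)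

variable {L : ℕ}

/-- The matrix whose columns are the columns of the channels of all users of group `ψ` other
than `k`. -/
def others (h : Channel L M) (ψ : Ψ) (k : Fin Q) :
    Matrix (Fin L) (Σ j : {j : Fin Q // j ≠ k}, Fin (M ψ j)) ℂ :=
  fun i x => h ψ x.1 i x.2

/-- The block-diagonalization projection `I - A* (Aᵀ A*)⁻¹ Aᵀ`, where `A` collects the channels of
the other users of the group and `A* = Aᵀᴴ` is the entrywise conjugate. -/
def proj (h : Channel L M) (ψ : Ψ) (k : Fin Q) : Matrix (Fin L) (Fin L) ℂ :=
  1 - (others h ψ k)ᵀᴴ * ((others h ψ k)ᵀ * (others h ψ k)ᵀᴴ)⁻¹ * (others h ψ k)ᵀ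

/-- The effective `M ψ k × M ψ k` matrix `Hᵀ T H*`. -/
def effGram (h : Channel L M) (ψ : Ψ) (k : Fin Q) : Matrix (Fin (M ψ k)) (Fin (M ψ k)) ℂ :=
  (h ψ k)ᵀ * proj h ψ k * (h ψ k)ᵀᴴ

theorem proj_isHermitian (h : Channel L M) (ψ : Ψ) (k : Fin Q) :
    (proj h ψ k).IsHermitian := by
  have h1 : ((others h ψ k)ᵀ * (others h ψ k)ᵀᴴ).IsHermitian :=
    isHermitian_mul_conjTranspose_self _
  exact isHermitian_one.sub (isHermitian_conjTranspose_mul_mul _ h1.inv)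

theorem effGram_isHermitian (h : Channel L M) (ψ : Ψ) (k : Fin Q) :
    (effGram h ψ k).IsHermitian :=
  isHermitian_mul_mul_conjTranspose _ (proj_isHermitian h ψ k)

/-- The eigenvalues, with multiplicity, of `Hᵀ T H*`. -/
def eigval (h : Channel L M) (ψ : Ψ) (k : Fin Q) : Fin (M ψ k) → ℝ :=
  (effGram_isHermitian h ψ k).eigenvalues

/-- `x / ‖x‖` for the Euclidean norm. -/
def unit {n : Type*} [Fintype n] (x : n → ℂ) : n → ℂ :=
  ((‖WithLp.toLp 2 x‖⁻¹ : ℝ) : ℂ) • x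

/-- The directions `m` define a BD-MRC design with `M ψ k` streams for every user: they are
nonzero, pairwise orthogonal eigenvectors of `T H* Hᵀ T` for nonzero eigenvalues. -/
def IsDesign (h : Channel L M) (m : Directions L M) : Prop :=
  ∀ (ψ : Ψ) (k : Fin Q),
    (∀ q, m ψ k q ≠ 0) ∧
    (∀ p q, p ≠ q → star (m ψ k p) ⬝ᵥ m ψ k q = 0) ∧
    (∀ q, ∃ l : ℝ, l ≠ 0 ∧
      (proj h ψ k * (h ψ k)ᵀᴴ * (h ψ k)ᵀ * proj h ψ k) *ᵥ m ψ k q = (l : ℂ) • m ψ k q)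

/-- The unit-norm BD precoding vector of stream `q` of user `(ψ, k)`. -/
def precoder (h : Channel L M) (m : Directions L M) (ψ : Ψ) (k : Fin Q) (q : Fin (M ψ k)) :
    Fin L → ℂ :=
  unit (proj h ψ k *ᵥ m ψ k q)

/-- The unit-norm maximum ratio combiner of stream `q` of user `(ψ, k)`. -/
def combiner (h : Channel L M) (m : Directions L M) (ψ : Ψ) (k : Fin Q) (q : Fin (M ψ k)) :
    Fin (M ψ k) → ℂ :=
  unit ((h ψ k)ᵀ *ᵥ precoder h m ψ k q)

/-- The gain with which stream `p` of user `(ψ, j)` arrives, after combining, in the decision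
variable of stream `q` of user `(ψ, k)`. -/
def gain (h : Channel L M) (m : Directions L M) (ψ : Ψ) (k : Fin Q) (q : Fin (M ψ k))
    (j : Fin Q) (p : Fin (M ψ j)) : ℝ :=
  ‖star (combiner h m ψ k q) ⬝ᵥ ((h ψ k)ᵀ *ᵥ precoder h m ψ j p)‖ ^ 2

/-- The SINR of stream `q` of user `(ψ, k)` after the removal of the inter-group interference by
means of the cached content. Both the interference between the streams of the user and that
from the other users of its group are accounted for; the precoding is what suppresses them. -/
def sinr (N₀ : ℝ) (h : Channel L M) (m : Directions L M) (P : Powers M)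
    (ψ : Ψ) (k : Fin Q) (q : Fin (M ψ k)) : ℝ :=
  P ψ k q * gain h m ψ k q k q /
    (N₀ + (∑ p ∈ Finset.univ.erase q, P ψ k p * gain h m ψ k q k p)
      + ∑ j ∈ Finset.univ.erase k, ∑ p, P ψ j p * gain h m ψ k q j p)

variable [Fintype Ψ]

/-- The effective rate of user `(ψ, k)`. -/
def rate (Θ T N₀ : ℝ) (h : Channel L M) (m : Directions L M) (P : Powers M)
    (ψ : Ψ) (k : Fin Q) : ℝ :=
  csiFactor M Θ T * ∑ q, Real.log (1 + sinr N₀ h m P ψ k q)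

/-- The effective sum-rate over all served users. -/
def sumRate (Θ T N₀ : ℝ) (h : Channel L M) (m : Directions L M) (P : Powers M) : ℝ :=
  ∑ ψ, ∑ k, rate Θ T N₀ h m P ψ k

/-- The smallest effective rate among the served users. -/
def minRate (Θ T N₀ : ℝ) (h : Channel L M) (m : Directions L M) (P : Powers M) : ℝ :=
  ⨅ u : Ψ × Fin Q, rate Θ T N₀ h m P u.1 u.2

/-- The total transmit power of an allocation. -/
def totalPower (P : Powers M) : ℝ := ∑ ψ, ∑ k, ∑ q, P ψ k q

/-- Nonnegative powers within the power budget. -/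
def Feasible (Ptot : ℝ) (P : Powers M) : Prop :=
  (∀ ψ k q, 0 ≤ P ψ k q) ∧ totalPower P ≤ Ptot

/-- `P` solves the max-min fairness problem. -/
def IsMMFOptimal (Θ T N₀ Ptot : ℝ) (h : Channel L M) (m : Directions L M) (P : Powers M) : Prop :=
  Feasible Ptot P ∧
    ∀ P' : Powers M, Feasible Ptot P' → minRate Θ T N₀ h m P' ≤ minRate Θ T N₀ h m P

/-- The quantity `β (L - M_ψ + M_{ψ,k})`. -/
def detEig (M : Ψ → Fin Q → ℕ) (β : Ψ → Fin Q → ℝ) (L : ℕ) (ψ : Ψ) (k : Fin Q) : ℝ :=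
  β ψ k * ((L : ℝ) - (groupAntennas M ψ : ℝ) + (M ψ k : ℝ))

/-- The power of each stream of user `(ψ, k)` in the explicit allocation with parameter `R`. -/
def detPower (Θ T N₀ : ℝ) (M : Ψ → Fin Q → ℕ) (β : Ψ → Fin Q → ℝ) (L : ℕ) (R : ℝ) :
    Powers M := fun ψ k _ =>
  N₀ * (Real.exp (R / (csiFactor M Θ T * (M ψ k : ℝ) * numUsers Ψ Q)) - 1) / detEig M β L ψ k

/-- `R` solves the exponential-sum equation for `L` transmit antennas. -/
def SolvesExpEq (Θ T N₀ Ptot : ℝ) (M : Ψ → Fin Q → ℕ) (β : Ψ → Fin Q → ℝ) (L : ℕ) (R : ℝ) :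
    Prop :=
  ∑ ψ, ∑ k, N₀ * (M ψ k : ℝ) *
      (Real.exp (R / (csiFactor M Θ T * (M ψ k : ℝ) * numUsers Ψ Q)) - 1) / detEig M β L ψ k
    = Ptot

/-- The closed-form sum-rate for a common number `M₀` of receive antennas. -/
def closedForm (Θ T N₀ Ptot : ℝ) (M : Ψ → Fin Q → ℕ) (β : Ψ → Fin Q → ℝ) (M₀ L : ℕ) : ℝ :=
  csiFactor M Θ T * numUsers Ψ Q * (M₀ : ℝ) *
    Real.log (1 + Ptot * ((L : ℝ) - ((Q : ℝ) - 1) * (M₀ : ℝ)) /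
      (N₀ * (M₀ : ℝ) * ∑ ψ, ∑ k, (β ψ k)⁻¹))

end Model

end VCC

end

/-! Randomness enters only through the law of large numbers. Divided by `L`, the inner products of
the channel columns of one group converge almost surely to those of orthogonal columns with squared
norms `β`. The rows for different `L` may depend on each other arbitrarily, so this rests on fourth
moments: the fourth moment of the average is `O(L⁻²)`, which is summable
(`ae_tendsto_average_zero`).

Everything after that is deterministic. The matrix `Hᵀ T H*` is a Schur complement of the Gram
matrix of the group. Its cross terms vanish at scale `L`, so after division by `L` it tends to `β
I`, and all its eigenvalues are asymptotic to `β L`, hence to `detEig`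
(`GramConverges.tendsto_eigenvalue`). Any BD-MRC design decouples the streams exactly, with such
eigenvalues as gains (`gain_of_isDesign`).

It remains to study max-min fairness for parallel channels whose gains agree with `detEig` up to a
factor `κ → 1`. The explicit allocation gives each user the rate `R / (G Q)` up to `O(log κ)`.
Conversely, by the inequality of arithmetic and geometric means, a user with rate `c` needs almost
the power of an equal split, so a larger minimum rate would exceed the budget
(`Decoupled.le_of_feasible`).

This controls the minimum rate but not yet the individual rates and powers. At an optimum, no user
spends more than is needed for the minimum rate: saved power, spread over all streams, would raise
every rate (`Decoupled.sum_le_of_isMMFOptimal`). Equality is therefore nearly attained in the mean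
inequality, and its stability version makes all factors `1 + SINR` of a user asymptotically equal.
The limits of rates and powers follow, and `R → ∞` turns the additive error into an asymptotic
equivalence. -/

namespace VCC

/-! ### Fourth moments and a strong law for triangular arrays -/

/-- Grouping of a doubly indexed independent family into independent rows. -/
theorem iIndepFun_rows {Ω ι κ 𝓧 : Type*} [MeasurableSpace Ω] {μ : Measure Ω} [Countable ι]
    [Countable κ] [MeasurableSpace 𝓧] {X : ι × κ → Ω → 𝓧} (hX : ∀ p, AEMeasurable (X p) μ)
    (h : iIndepFun X μ) : iIndepFun (fun i ω j => X (i, j) ω) μ := by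
  have := h.isProbabilityMeasure
  have hprob : ∀ i j, IsProbabilityMeasure (μ.map (X (i, j))) :=
    fun i j => Measure.isProbabilityMeasure_map (hX _)
  rw [iIndepFun_iff_map_fun_eq_infinitePi_map₀' (fun i => aemeasurable_pi_iff.2 fun j => hX _)]
  have h1 : (fun ω i j => X (i, j) ω) = (MeasurableEquiv.curry ι κ 𝓧) ∘ (fun ω p => X p ω) := by
    ext; simp
  rw [h1, ← AEMeasurable.map_map_of_aemeasurable (by fun_prop) (aemeasurable_pi_iff.2 hX),
    h.map_fun_eq_infinitePi_map₀' hX]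
  have h2 := Measure.infinitePi_map_curry (fun i j => μ.map (X (i, j)))
  rw [h2]
  congr 1
  ext1 i
  have h3 : iIndepFun (fun j => X (i, j)) μ :=
    h.precomp (g := fun j => (i, j)) (Prod.mk_right_injective i)
  rw [h3.map_fun_eq_infinitePi_map₀' (fun j => hX _)]

theorem integrable_pow_of_memLp_four {Ω : Type*} [MeasurableSpace Ω] {μ : Measure Ω}
    [IsFiniteMeasure μ] {X : Ω → ℝ} (hX : MemLp X 4 μ) {k : ℕ} (hk : k ≤ 4) :
    Integrable (fun ω => X ω ^ k) μ := by
  have h : MemLp X k μ := hX.mono_exponent (by exact_mod_cast hk)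
  have := h.integrable_norm_pow'
  refine this.mono (hX.aestronglyMeasurable.pow k) (ae_of_all _ fun ω => ?_)
  simp

/-- Terms are added one at a time. The new term is centred and independent of the partial sum, so
the mixed moments with a first power vanish, and only `6 E[S²] E[X²]` survives in the fourth moment.
This is why both bounds are carried through one induction. The constant `1 + K` bounds the second
moments through `x² ≤ 1 + x⁴`. -/
theorem integral_sq_sum_le {Ω ι : Type*} [MeasurableSpace Ω] {μ : Measure Ω}
    {X : ι → Ω → ℝ} (h : iIndepFun X μ) (hX : ∀ i, MemLp (X i) 4 μ)
    (h0 : ∀ i, ∫ ω, X i ω ∂μ = 0) {K : ℝ} (hK : ∀ i, ∫ ω, X i ω ^ 4 ∂μ ≤ K) (s : Finset ι) :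
    ∫ ω, (∑ i ∈ s, X i ω) ^ 2 ∂μ ≤ s.card * (1 + K) ∧
    ∫ ω, (∑ i ∈ s, X i ω) ^ 4 ∂μ ≤ 6 * (s.card * (1 + K)) ^ 2 + s.card * K := by
  classical
  have := h.isProbabilityMeasure
  induction s using Finset.induction_on with
  | empty => simp
  | insert a s ha ih =>
    obtain ⟨ih2, ih4⟩ := ih
    have hS : MemLp (fun ω => ∑ i ∈ s, X i ω) 4 μ := memLp_finsetSum s fun i _ => hX i
    set S : Ω → ℝ := fun ω => ∑ i ∈ s, X i ω with hSdef
    have hind : IndepFun S (X a) μ := by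
      have := h.indepFun_finsetSum_of_notMem₀ (fun i => (hX i).aestronglyMeasurable.aemeasurable) ha
      convert this using 1
      ext ω; simp [hSdef]
    have hpow : ∀ j k : ℕ, j ≤ 4 → k ≤ 4 → Integrable (fun ω => S ω ^ j * X a ω ^ k) μ ∧
        ∫ ω, S ω ^ j * X a ω ^ k ∂μ = (∫ ω, S ω ^ j ∂μ) * ∫ ω, X a ω ^ k ∂μ := by
      intro j k hj hk
      refine ⟨?_, ?_⟩
      · have := (hind.comp (measurable_id.pow_const j) (measurable_id.pow_const k)).integrable_mul
          (integrable_pow_of_memLp_four hS hj) (integrable_pow_of_memLp_four (hX a) hk)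
        exact this
      · exact hind.integral_fun_comp_mul_comp (f := fun x => x ^ j) (g := fun x => x ^ k)
          hS.aestronglyMeasurable.aemeasurable (hX a).aestronglyMeasurable.aemeasurable
          (by fun_prop) (by fun_prop)
    have hX2 : ∫ ω, X a ω ^ 2 ∂μ ≤ 1 + K := by
      calc ∫ ω, X a ω ^ 2 ∂μ ≤ ∫ ω, (1 + X a ω ^ 4) ∂μ := by
            apply integral_mono (integrable_pow_of_memLp_four (hX a) (by norm_num))
              ((integrable_const 1).add (integrable_pow_of_memLp_four (hX a) le_rfl))
            intro ω
            simp only [Pi.add_apply]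
            nlinarith [sq_nonneg (X a ω ^ 2 - 1), sq_nonneg (X a ω)]
        _ = 1 + ∫ ω, X a ω ^ 4 ∂μ := by
            rw [integral_add (integrable_const 1) (integrable_pow_of_memLp_four (hX a) le_rfl)]
            simp
        _ ≤ 1 + K := by linarith [hK a]
    have hX20 : 0 ≤ ∫ ω, X a ω ^ 2 ∂μ := integral_nonneg fun ω => sq_nonneg _
    have hS20 : 0 ≤ ∫ ω, S ω ^ 2 ∂μ := integral_nonneg fun ω => sq_nonneg _
    have hX40 : 0 ≤ ∫ ω, X a ω ^ 4 ∂μ := integral_nonneg fun ω => by positivity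
    have hK0 : 0 ≤ K := hX40.trans (hK a)
    have e2 : ∫ ω, (S ω + X a ω) ^ 2 ∂μ = ∫ ω, S ω ^ 2 ∂μ + ∫ ω, X a ω ^ 2 ∂μ := by
      have : ∀ ω, (S ω + X a ω) ^ 2 = S ω ^ 2 * X a ω ^ 0 + 2 * (S ω ^ 1 * X a ω ^ 1)
        + S ω ^ 0 * X a ω ^ 2 := fun ω => by ring
      simp_rw [this]
      have i1 := (hpow 2 0 (by norm_num) (by norm_num)).1
      have i2 := (hpow 1 1 (by norm_num) (by norm_num)).1.const_mul 2
      have i3 := (hpow 0 2 (by norm_num) (by norm_num)).1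
      have e := integral_add' (i1.add i2) i3
      rw [integral_add' i1 i2, integral_const_mul, (hpow 1 1 (by norm_num) (by norm_num)).2] at e
      refine e.trans ?_
      simp [h0]
    have e4 : ∫ ω, (S ω + X a ω) ^ 4 ∂μ = ∫ ω, S ω ^ 4 ∂μ +
        6 * ((∫ ω, S ω ^ 2 ∂μ) * ∫ ω, X a ω ^ 2 ∂μ)
        + 4 * ((∫ ω, S ω ∂μ) * ∫ ω, X a ω ^ 3 ∂μ) + ∫ ω, X a ω ^ 4 ∂μ := by
      have : ∀ ω, (S ω + X a ω) ^ 4 = S ω ^ 4 * X a ω ^ 0 + 4 * (S ω ^ 3 * X a ω ^ 1)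
        + 6 * (S ω ^ 2 * X a ω ^ 2) + 4 * (S ω ^ 1 * X a ω ^ 3)
        + S ω ^ 0 * X a ω ^ 4 := fun ω => by ring
      simp_rw [this]
      have i1 := (hpow 4 0 (by norm_num) (by norm_num)).1
      have i2 := (hpow 3 1 (by norm_num) (by norm_num)).1.const_mul 4
      have i3 := (hpow 2 2 (by norm_num) (by norm_num)).1.const_mul 6
      have i4 := (hpow 1 3 (by norm_num) (by norm_num)).1.const_mul 4
      have i5 := (hpow 0 4 (by norm_num) (by norm_num)).1
      have e := integral_add' (((i1.add i2).add i3).add i4) i5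
      rw [integral_add' ((i1.add i2).add i3) i4, integral_add' (i1.add i2) i3,
        integral_add' i1 i2, integral_const_mul, integral_const_mul,
        integral_const_mul, (hpow 3 1 (by norm_num) (by norm_num)).2,
        (hpow 2 2 (by norm_num) (by norm_num)).2, (hpow 1 3 (by norm_num) (by norm_num)).2] at e
      refine e.trans ?_
      simp [h0]
    have hS0 : ∫ ω, S ω ∂μ = 0 := by
      rw [integral_finsetSum _ fun i _ => ?_]
      · simp [h0]
      · simpa using integrable_pow_of_memLp_four (hX i) (k := 1) (by norm_num)
    have hsum : ∀ ω, ∑ i ∈ insert a s, X i ω = S ω + X a ω := fun ω => by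
      rw [Finset.sum_insert ha, add_comm]
    simp_rw [hsum, Finset.card_insert_of_notMem ha]
    push_cast
    rw [e2, e4, hS0]
    refine ⟨by linarith, ?_⟩
    have : (∫ ω, S ω ^ 2 ∂μ) * ∫ ω, X a ω ^ 2 ∂μ ≤ (s.card * (1 + K)) * (1 + K) := by
      gcongr
    have := hK a
    nlinarith [mul_nonneg (Nat.cast_nonneg (α := ℝ) s.card) (sq_nonneg (1 + K)), sq_nonneg (1 + K)]

/-- A strong law for triangular arrays with arbitrary dependence between the rows. -/
theorem ae_tendsto_average_zero {Ω : Type*} [MeasurableSpace Ω] {μ : Measure Ω}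
    {X : ∀ L : ℕ, Fin L → Ω → ℝ} (h : ∀ L, iIndepFun (X L) μ) (hX : ∀ L i, MemLp (X L i) 4 μ)
    (h0 : ∀ L i, ∫ ω, X L i ω ∂μ = 0) {K : ℝ} (hK : ∀ L i, ∫ ω, X L i ω ^ 4 ∂μ ≤ K) :
    ∀ᵐ ω ∂μ, Tendsto (fun L : ℕ => (∑ i, X L i ω) / L) atTop (𝓝 0) := by
  have := (h 0).isProbabilityMeasure
  have hK0 : 0 ≤ K := (integral_nonneg fun ω => by positivity).trans (hK 1 0)
  set C : ℝ := 6 * (1 + K) ^ 2 + K with hC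
  have hC0 : 0 ≤ C := by positivity
  have hS : ∀ L, MemLp (fun ω => ∑ i, X L i ω) 4 μ := fun L => memLp_finsetSum _ fun i _ => hX L i
  set V : ℕ → Ω → ℝ := fun L ω => ((∑ i, X L i ω) / L) ^ 4 with hV
  have hVint : ∀ L, Integrable (V L) μ := by
    intro L
    simp only [hV, div_pow]
    exact (integrable_pow_of_memLp_four (hS L) le_rfl).div_const _
  have hVle : ∀ L : ℕ, ∫ ω, V L ω ∂μ ≤ C * (1 / (L : ℝ) ^ 2) := by
    intro L
    rcases Nat.eq_zero_or_pos L with rfl | hL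
    · simp [hV]
    have hb := (integral_sq_sum_le (h L) (hX L) (h0 L) (hK L) Finset.univ).2
    simp only [hV, div_pow, integral_div, Finset.card_univ, Fintype.card_fin] at hb ⊢
    have hL1 : (1 : ℝ) ≤ L := by exact_mod_cast hL
    rw [div_le_iff₀ (by positivity)]
    refine hb.trans ?_
    have : C * (1 / (L : ℝ) ^ 2) * L ^ 4 = C * L ^ 2 := by field_simp
    rw [this, hC]
    nlinarith [mul_le_mul_of_nonneg_left hL1 (mul_nonneg hK0 (by positivity : (0:ℝ) ≤ L))]
  have hsum : Summable fun L : ℕ => C * (1 / (L : ℝ) ^ 2) :=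
    (Real.summable_one_div_nat_pow.2 (by norm_num)).mul_left C
  -- By Tonelli the series of fourth powers has finite expectation, so it converges almost surely
  -- and its terms tend to zero. No joint law of different `L` is involved.
  have hfin : ∫⁻ ω, ∑' L, ENNReal.ofReal (V L ω) ∂μ ≠ ⊤ := by
    rw [lintegral_tsum fun L => (hVint L).aestronglyMeasurable.aemeasurable.ennreal_ofReal]
    refine ne_top_of_le_ne_top hsum.tsum_ofReal_ne_top (ENNReal.tsum_le_tsum fun L => ?_)
    rw [← ofReal_integral_eq_lintegral_ofReal (hVint L) (ae_of_all _ fun ω => by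
      simp only [hV, Pi.zero_apply]; positivity)]
    exact ENNReal.ofReal_le_ofReal (hVle L)
  filter_upwards [ae_lt_top' (AEMeasurable.tsum fun L =>
    (hVint L).aestronglyMeasurable.aemeasurable.ennreal_ofReal) hfin] with ω hω
  have h1 : Tendsto (fun L => ENNReal.ofReal (V L ω)) atTop (𝓝 0) :=
    ENNReal.tendsto_atTop_zero_of_tsum_ne_top hω.ne
  have h2 : Tendsto (fun L => V L ω) atTop (𝓝 0) := by
    have := (ENNReal.tendsto_toReal ENNReal.zero_ne_top).comp h1
    refine this.congr fun L => ?_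
    simp only [Function.comp]
    exact ENNReal.toReal_ofReal (by simp only [hV]; positivity)
  have h3 := h2.sqrt.sqrt
  simp only [Real.sqrt_zero] at h3
  rw [tendsto_zero_iff_abs_tendsto_zero]
  refine h3.congr fun L => ?_
  simp only [hV, Function.comp]
  rw [show ∀ x : ℝ, x ^ 4 = (x ^ 2) ^ 2 from fun x => by ring, Real.sqrt_sq (sq_nonneg _),
    Real.sqrt_sq_eq_abs]

/-! ### Moments of the complex Gaussian law -/

instance complexGaussian.isProbabilityMeasure (v : ℝ) : IsProbabilityMeasure (complexGaussian v) :=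
  Measure.isProbabilityMeasure_map (by fun_prop)

theorem measurableEquivRealProd_symm_eq (x : ℝ × ℝ) :
    Complex.measurableEquivRealProd.symm x = (x.1 : ℂ) + (x.2 : ℂ) * Complex.I := by
  apply Complex.ext <;> simp [Complex.measurableEquivRealProd]

theorem memLp_re_add_im {g : Measure ℝ} [IsProbabilityMeasure g] {p : ENNReal}
    (h : MemLp (fun x : ℝ => x) p g) :
    MemLp (fun x : ℝ × ℝ => (x.1 : ℂ) + (x.2 : ℂ) * Complex.I) p (g.prod g) := by
  have hre : MemLp (fun x : ℝ × ℝ => x.1) p (g.prod g) :=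
    h.comp_measurePreserving measurePreserving_fst
  have him : MemLp (fun x : ℝ × ℝ => x.2) p (g.prod g) :=
    h.comp_measurePreserving measurePreserving_snd
  have h1 : MemLp (fun x : ℝ × ℝ => (x.1 : ℂ)) p (g.prod g) := Complex.ofRealCLM.comp_memLp' hre
  have h2 : MemLp (fun x : ℝ × ℝ => (x.2 : ℂ)) p (g.prod g) := Complex.ofRealCLM.comp_memLp' him
  exact h1.add (h2.mul_const Complex.I)

theorem memLp_id_complexGaussian (v : ℝ) {p : ENNReal} (hp : p ≠ ⊤) :
    MemLp (fun z : ℂ => z) p (complexGaussian v) := by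
  rw [complexGaussian, memLp_map_measure_iff (g := fun z : ℂ => z) aestronglyMeasurable_id
    (Complex.measurableEquivRealProd.symm.measurable.aemeasurable)]
  refine (memLp_re_add_im (memLp_id_gaussianReal' p hp)).congr_norm
    (Complex.measurableEquivRealProd.symm.measurable.aestronglyMeasurable)
    (ae_of_all _ fun x => ?_)
  rw [← measurableEquivRealProd_symm_eq]
  rfl

theorem integral_id_complexGaussian (v : ℝ) : ∫ z, z ∂complexGaussian v = 0 := by
  have hint := (memLp_id_complexGaussian v (p := 1) (by simp)).integrable le_rfl
  have key : ∀ f : ℂ → ℝ, ∫ z, f z ∂complexGaussian v =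
      ∫ x, f (Complex.measurableEquivRealProd.symm x)
        ∂((gaussianReal 0 (v / 2).toNNReal).prod (gaussianReal 0 (v / 2).toNNReal)) := fun f =>
    integral_map_equiv _ _
  apply Complex.ext
  · have h := integral_re (𝕜 := ℂ) hint
    simp only [RCLike.re_eq_complex_re] at h
    rw [← h, key]
    have := integral_fun_fst (μ := gaussianReal 0 (v / 2).toNNReal)
      (ν := gaussianReal 0 (v / 2).toNNReal) (f := fun x => x)
    simpa [Complex.measurableEquivRealProd] using this
  · have h := integral_im (𝕜 := ℂ) hint
    simp only [RCLike.im_eq_complex_im] at h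
    rw [← h, key]
    have := integral_fun_snd (μ := gaussianReal 0 (v / 2).toNNReal)
      (ν := gaussianReal 0 (v / 2).toNNReal) (f := fun x => x)
    simpa [Complex.measurableEquivRealProd] using this

theorem integral_sq_gaussianReal (v : ℝ≥0) : ∫ x, x ^ 2 ∂gaussianReal 0 v = v := by
  have h := variance_id_gaussianReal (μ := 0) (v := v)
  rw [variance_eq_integral (by fun_prop)] at h
  simpa using h

theorem integral_mul_star_complexGaussian {v : ℝ} (hv : 0 ≤ v) :
    ∫ z, z * star z ∂complexGaussian v = (v : ℂ) := by
  have h1 : ∀ z : ℂ, z * star z = ((z.re ^ 2 + z.im ^ 2 : ℝ) : ℂ) := fun z => by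
    rw [Complex.star_def, Complex.mul_conj, Complex.normSq_apply]; push_cast; ring
  simp_rw [h1]
  refine (integral_ofReal (𝕜 := ℂ)).trans (congrArg _
    (?_ : ∫ z : ℂ, (z.re ^ 2 + z.im ^ 2) ∂complexGaussian v = v))
  set g := gaussianReal 0 (v / 2).toNNReal
  have key : ∫ z : ℂ, (z.re ^ 2 + z.im ^ 2) ∂complexGaussian v =
      ∫ x : ℝ × ℝ, (x.1 ^ 2 + x.2 ^ 2) ∂(g.prod g) := by
    rw [complexGaussian, integral_map_equiv]
    simp [Complex.measurableEquivRealProd, g]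
  have hi : Integrable (fun x : ℝ => x ^ 2) g := by
    have := (memLp_id_gaussianReal' (μ := 0) (v := (v / 2).toNNReal) 2 (by simp)).integrable_sq
    simpa using this
  rw [key, integral_add (hi.comp_fst g) (hi.comp_snd g)]
  have e1 := integral_fun_fst (μ := g) (ν := g) (f := fun x => x ^ 2)
  have e2 := integral_fun_snd (μ := g) (ν := g) (f := fun x => x ^ 2)
  rw [e1, e2, integral_sq_gaussianReal]
  simp [Real.coe_toNNReal _ (div_nonneg hv zero_le_two)]

section

variable {Ω : Type*} [MeasurableSpace Ω] {μ : Measure Ω} {Z W : Ω → ℂ} {v w : ℝ}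

theorem memLp_of_hasLaw (hZ : HasLaw Z (complexGaussian v) μ) {p : ENNReal} (hp : p ≠ ⊤) :
    MemLp Z p μ := by
  have h := memLp_id_complexGaussian v hp
  rw [← hZ.map_eq] at h
  exact (memLp_map_measure_iff (by fun_prop) hZ.aemeasurable).1 h

theorem integral_mul_star_of_indep (hZ : HasLaw Z (complexGaussian v) μ)
    (hW : HasLaw W (complexGaussian w) μ) (h : IndepFun Z W μ) :
    ∫ ω, Z ω * star (W ω) ∂μ = 0 := by
  rw [h.integral_fun_comp_mul_comp (f := fun z => z) (g := fun z => star z) hZ.aemeasurable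
    hW.aemeasurable (by fun_prop) (by fun_prop), hZ.integral_eq, integral_id_complexGaussian,
    zero_mul]

theorem integral_mul_star_self (hZ : HasLaw Z (complexGaussian v) μ) (hv : 0 ≤ v) :
    ∫ ω, Z ω * star (Z ω) ∂μ = v := by
  rw [← integral_mul_star_complexGaussian hv,
    ← hZ.integral_comp (f := fun z => z * star z) (by fun_prop)]
  rfl

/-- Hölder's inequality with exponents `8, 8, 4`: the fourth moment needed for the strong law costs
eighth moments of the entries. -/
theorem memLp_mul_star_sub [IsProbabilityMeasure μ] (hZ : HasLaw Z (complexGaussian v) μ)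
    (hW : HasLaw W (complexGaussian w) μ) (c : ℂ) :
    MemLp (fun ω => Z ω * star (W ω) - c) 4 μ := by
  have : ENNReal.HolderTriple 8 8 4 := ⟨by
    rw [← two_mul, show (8 : ENNReal) = 2 * 4 by norm_num, ENNReal.mul_inv (by simp) (by simp),
      ← mul_assoc, ENNReal.mul_inv_cancel (by simp) (by simp), one_mul]⟩
  have h1 := (memLp_of_hasLaw hZ (p := 8) (by simp)).mul (memLp_of_hasLaw hW (p := 8) (by simp)).star
    (r := 4)
  have h2 := h1.sub (memLp_const c)
  refine h2.congr_norm (by exact h2.aestronglyMeasurable.congr (ae_of_all _ fun ω => by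
    simp [mul_comm])) (ae_of_all _ fun ω => by simp [mul_comm])

/-- The bound depends on the two laws and on `c` only, so it serves all antennas and all `L` at
once. The constant is `27 = 3 · 3²`, from applying the Cauchy–Schwarz inequality for three summands
twice. -/
theorem integral_norm_mul_star_sub_le [IsProbabilityMeasure μ]
    (hZ : HasLaw Z (complexGaussian v) μ) (hW : HasLaw W (complexGaussian w) μ) (c : ℂ) :
    ∫ ω, ‖Z ω * star (W ω) - c‖ ^ 4 ∂μ ≤
      27 * (∫ z, ‖z‖ ^ 8 ∂complexGaussian v + ∫ z, ‖z‖ ^ 8 ∂complexGaussian w + ‖c‖ ^ 4) := by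
  have i1 : Integrable (fun ω => ‖Z ω‖ ^ 8) μ := by
    simpa using (memLp_of_hasLaw hZ (p := (8 : ℕ)) (by simp)).integrable_norm_pow'
  have i2 : Integrable (fun ω => ‖W ω‖ ^ 8) μ := by
    simpa using (memLp_of_hasLaw hW (p := (8 : ℕ)) (by simp)).integrable_norm_pow'
  have i3 : Integrable (fun ω => ‖Z ω * star (W ω) - c‖ ^ 4) μ := by
    simpa using (show MemLp _ ((4 : ℕ) : ENNReal) μ from
      memLp_mul_star_sub hZ hW c).integrable_norm_pow'
  have e1 : ∫ ω, ‖Z ω‖ ^ 8 ∂μ = ∫ z, ‖z‖ ^ 8 ∂complexGaussian v :=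
    hZ.integral_comp (f := fun z => ‖z‖ ^ 8) (by fun_prop)
  have e2 : ∫ ω, ‖W ω‖ ^ 8 ∂μ = ∫ z, ‖z‖ ^ 8 ∂complexGaussian w :=
    hW.integral_comp (f := fun z => ‖z‖ ^ 8) (by fun_prop)
  calc _ ≤ ∫ ω, 27 * (‖Z ω‖ ^ 8 + ‖W ω‖ ^ 8 + ‖c‖ ^ 4) ∂μ := by
        refine integral_mono i3 (((i1.add i2).add (integrable_const _)).const_mul 27) fun ω => ?_
        have h1 : ‖Z ω * star (W ω) - c‖ ≤ ‖Z ω‖ ^ 2 + ‖W ω‖ ^ 2 + ‖c‖ := by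
          refine (norm_sub_le _ _).trans ?_
          rw [norm_mul, norm_star]
          nlinarith [sq_nonneg (‖Z ω‖ - ‖W ω‖), sq_nonneg (‖Z ω‖ + ‖W ω‖)]
        have h2 : ∀ a b c : ℝ, (a + b + c) ^ 4 ≤ 27 * (a ^ 4 + b ^ 4 + c ^ 4) := fun a b c => by
          have h3 : (a + b + c) ^ 2 ≤ 3 * (a ^ 2 + b ^ 2 + c ^ 2) := by
            nlinarith [sq_nonneg (a - b), sq_nonneg (b - c), sq_nonneg (a - c)]
          have h4 : (a ^ 2 + b ^ 2 + c ^ 2) ^ 2 ≤ 3 * (a ^ 4 + b ^ 4 + c ^ 4) := by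
            nlinarith [sq_nonneg (a ^ 2 - b ^ 2), sq_nonneg (b ^ 2 - c ^ 2),
              sq_nonneg (a ^ 2 - c ^ 2)]
          have h5 := pow_le_pow_left₀ (sq_nonneg _) h3 2
          nlinarith
        calc ‖Z ω * star (W ω) - c‖ ^ 4 ≤ (‖Z ω‖ ^ 2 + ‖W ω‖ ^ 2 + ‖c‖) ^ 4 := by gcongr
          _ ≤ _ := h2 _ _ _
          _ = 27 * (‖Z ω‖ ^ 8 + ‖W ω‖ ^ 8 + ‖c‖ ^ 4) := by ring
    _ = _ := by
        have e := integral_add' (i1.add i2) (integrable_const (μ := μ) (‖c‖ ^ 4))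
        rw [integral_add' i1 i2, e1, e2] at e
        rw [integral_const_mul]
        congr 1
        refine e.trans ?_
        simp

end

/-! ### Almost sure limits of the Gram entries -/

/-- The summands belong to different antennas `i`, hence are independent, with mean `β` on the
diagonal and `0` off it. Once centred, their real and imaginary parts each satisfy the strong law.
-/
theorem ae_tendsto_gram_entry {Ψ : Type*} {Q : ℕ} {M : Ψ → Fin Q → ℕ}
    {β : Ψ → Fin Q → ℝ} (hβ : ∀ ψ k, 0 < β ψ k)
    {Ω : Type*} [MeasurableSpace Ω] {μ : Measure Ω} [IsProbabilityMeasure μ]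
    {H : ∀ L : ℕ, Ω → Channel L M} (hH : ∀ L : ℕ, IsRayleigh μ β (H L)) (ψ : Ψ)
    (c d : Σ k, Fin (M ψ k)) :
    ∀ᵐ ω ∂μ, Tendsto (fun L : ℕ => (∑ i, H L ω ψ c.1 i c.2 * star (H L ω ψ d.1 i d.2)) / (L : ℂ))
      atTop (𝓝 (if c = d then (β ψ c.1 : ℂ) else 0)) := by
  set b : ℂ := if c = d then (β ψ c.1 : ℂ) else 0 with hb
  set X : ∀ L : ℕ, Fin L → Ω → ℂ := fun L i ω =>
    H L ω ψ c.1 i c.2 * star (H L ω ψ d.1 i d.2) - b with hX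
  have hindep : ∀ L, iIndepFun (X L) μ := by
    intro L
    -- The entries of the group are reindexed by (antenna, column) and grouped by antenna, since
    -- each summand is a function of one antenna's row.
    have h1 := (hH L).indep.precomp
      (g := fun p : Fin L × (Σ k, Fin (M ψ k)) => (⟨(ψ, p.2.1), (p.1, p.2.2)⟩ :
        Σ u : Ψ × Fin Q, Fin L × Fin (M u.1 u.2))) (by
        rintro ⟨i, k, j⟩ ⟨i', k', j'⟩ h
        simp only [Sigma.mk.injEq, Prod.mk.injEq, true_and] at h
        obtain ⟨rfl, h⟩ := h
        simp only [heq_eq_eq, Prod.mk.injEq] at h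
        simp [h.1, h.2])
    have h2 := iIndepFun_rows (X := fun (p : Fin L × (Σ k, Fin (M ψ k))) ω =>
      H L ω ψ p.2.1 p.1 p.2.2) (fun p => ((hH L).law ψ p.2.1 p.1 p.2.2).aemeasurable) h1
    exact h2.comp (fun _ x => x c * star (x d) - b) (fun _ => by fun_prop)
  have hlp : ∀ L i, MemLp (X L i) 4 μ := fun L i =>
    memLp_mul_star_sub ((hH L).law ψ c.1 i c.2) ((hH L).law ψ d.1 i d.2) b
  have h0 : ∀ L i, ∫ ω, X L i ω ∂μ = 0 := by
    intro L i
    have hint : Integrable (fun ω => H L ω ψ c.1 i c.2 * star (H L ω ψ d.1 i d.2)) μ := by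
      have := (memLp_mul_star_sub ((hH L).law ψ c.1 i c.2) ((hH L).law ψ d.1 i d.2) 0).integrable
        (by norm_num)
      simpa using this
    simp only [hX]
    rw [integral_sub hint (integrable_const b)]
    simp only [integral_const, probReal_univ, one_smul]
    rw [sub_eq_zero, hb]
    split_ifs with hcd
    · subst hcd
      exact integral_mul_star_self ((hH L).law ψ c.1 i c.2) (hβ _ _).le
    · refine integral_mul_star_of_indep ((hH L).law ψ c.1 i c.2) ((hH L).law ψ d.1 i d.2) ?_
      refine (hH L).indep.indepFun (i := ⟨(ψ, c.1), (i, c.2)⟩) (j := ⟨(ψ, d.1), (i, d.2)⟩) ?_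
      intro h
      apply hcd
      obtain ⟨k, j⟩ := c
      obtain ⟨k', j'⟩ := d
      simp only [Sigma.mk.injEq, Prod.mk.injEq, true_and] at h
      obtain ⟨rfl, h⟩ := h
      simp only [heq_eq_eq, Prod.mk.injEq, true_and] at h
      simp [h]
  set K : ℝ := 27 * (∫ z, ‖z‖ ^ 8 ∂complexGaussian (β ψ c.1) +
    ∫ z, ‖z‖ ^ 8 ∂complexGaussian (β ψ d.1) + ‖b‖ ^ 4)
  have hK : ∀ L i, ∫ ω, ‖X L i ω‖ ^ 4 ∂μ ≤ K := fun L i =>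
    integral_norm_mul_star_sub_le ((hH L).law ψ c.1 i c.2) ((hH L).law ψ d.1 i d.2) b
  have hi4 : ∀ L i, Integrable (fun ω => ‖X L i ω‖ ^ 4) μ := fun L i => by
    simpa using (show MemLp (X L i) ((4 : ℕ) : ENNReal) μ from hlp L i).integrable_norm_pow'
  have hre := ae_tendsto_average_zero (μ := μ) (X := fun L i ω => (X L i ω).re)
    (fun L => (hindep L).comp (fun _ z => z.re) (fun _ => by fun_prop))
    (fun L i => (hlp L i).re) (fun L i => by
      have := integral_re (𝕜 := ℂ) ((hlp L i).integrable (by norm_num))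
      simp only [RCLike.re_eq_complex_re] at this
      rw [this, h0]; simp) (K := K) (fun L i => by
      refine (integral_mono (integrable_pow_of_memLp_four (hlp L i).re le_rfl) (hi4 L i)
        fun ω => ?_).trans (hK L i)
      have := pow_le_pow_left₀ (abs_nonneg _) (Complex.abs_re_le_norm (X L i ω)) 4
      rwa [Even.pow_abs (by decide)] at this)
  have him := ae_tendsto_average_zero (μ := μ) (X := fun L i ω => (X L i ω).im)
    (fun L => (hindep L).comp (fun _ z => z.im) (fun _ => by fun_prop))
    (fun L i => (hlp L i).im) (fun L i => by
      have := integral_im (𝕜 := ℂ) ((hlp L i).integrable (by norm_num))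
      simp only [RCLike.im_eq_complex_im] at this
      rw [this, h0]; simp) (K := K) (fun L i => by
      refine (integral_mono (integrable_pow_of_memLp_four (hlp L i).im le_rfl) (hi4 L i)
        fun ω => ?_).trans (hK L i)
      have := pow_le_pow_left₀ (abs_nonneg _) (Complex.abs_im_le_norm (X L i ω)) 4
      rwa [Even.pow_abs (by decide)] at this)
  filter_upwards [hre, him] with ω h1 h2
  have h3 : Tendsto (fun L : ℕ => (((∑ i, (X L i ω).re) / L : ℝ) : ℂ) +
      (((∑ i, (X L i ω).im) / L : ℝ) : ℂ) * Complex.I + b) atTop (𝓝 (0 + 0 * Complex.I + b)) :=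
    (((Complex.continuous_ofReal.tendsto 0).comp h1).add
      (((Complex.continuous_ofReal.tendsto 0).comp h2).mul_const _)).add_const b
  simp only [zero_mul, zero_add] at h3
  refine h3.congr' ?_
  filter_upwards [eventually_gt_atTop 0] with L hL
  have hL' : (L : ℂ) ≠ 0 := by exact_mod_cast hL.ne'
  have h4 : (((∑ i, (X L i ω).re : ℝ) : ℂ)) + ((∑ i, (X L i ω).im : ℝ) : ℂ) * Complex.I =
      ∑ i, X L i ω := by
    push_cast
    rw [Finset.sum_mul, ← Finset.sum_add_distrib]
    exact Finset.sum_congr rfl fun i _ => Complex.re_add_im _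
  have h5 : ∑ i, X L i ω =
      ∑ i, H L ω ψ c.1 i c.2 * star (H L ω ψ d.1 i d.2) - L * b := by
    simp [hX]
  push_cast at h4 ⊢
  rw [div_mul_eq_mul_div, ← add_div, h4, h5]
  field_simp
  ring

/-! ### Algebra of block diagonalization -/

theorem star_dotProduct_self {n : Type*} [Fintype n] (x : n → ℂ) :
    star x ⬝ᵥ x = ((‖WithLp.toLp 2 x‖ ^ 2 : ℝ) : ℂ) := by
  rw [EuclideanSpace.norm_sq_eq]
  simp only [dotProduct, Pi.star_apply, Complex.ofReal_sum]
  refine Finset.sum_congr rfl fun i _ => ?_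
  rw [Complex.star_def, Complex.conj_mul']
  simp

theorem norm_toLp_pos {n : Type*} [Fintype n] {x : n → ℂ} (hx : x ≠ 0) :
    0 < ‖WithLp.toLp 2 x‖ := by
  rw [norm_pos_iff]
  simpa using hx

section Algebra

variable {Ψ : Type*} {Q : ℕ} {M : Ψ → Fin Q → ℕ} {L : ℕ}

/-- The Gram matrix of the channels of the other users of the group. -/
def othersGram (h : Channel L M) (ψ : Ψ) (k : Fin Q) :
    Matrix (Σ j : {j : Fin Q // j ≠ k}, Fin (M ψ j)) (Σ j : {j : Fin Q // j ≠ k}, Fin (M ψ j)) ℂ :=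
  (others h ψ k)ᵀ * (others h ψ k)ᵀᴴ

variable {h : Channel L M} {ψ : Ψ} {k : Fin Q}

theorem othersT_mul_proj (hu : IsUnit (othersGram h ψ k).det) :
    (others h ψ k)ᵀ * proj h ψ k = 0 := by
  have h1 : (others h ψ k)ᵀ * (others h ψ k)ᵀᴴ * ((others h ψ k)ᵀ * (others h ψ k)ᵀᴴ)⁻¹ = 1 :=
    Matrix.mul_nonsing_inv _ hu
  rw [proj, Matrix.mul_sub, Matrix.mul_one, ← Matrix.mul_assoc, ← Matrix.mul_assoc, h1,
    Matrix.one_mul, sub_self]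

theorem proj_mul_self (hu : IsUnit (othersGram h ψ k).det) :
    proj h ψ k * proj h ψ k = proj h ψ k := by
  conv_lhs => enter [1]; rw [proj]
  rw [Matrix.sub_mul, Matrix.one_mul, Matrix.mul_assoc _ _ (proj h ψ k), othersT_mul_proj hu,
    Matrix.mul_zero, sub_zero]

theorem channelT_mul_proj_of_ne (hu : IsUnit (othersGram h ψ k).det) {j : Fin Q} (hj : j ≠ k) :
    (h ψ j)ᵀ * proj h ψ k = 0 := by
  ext q i
  have := congrFun (congrFun (othersT_mul_proj hu) ⟨⟨j, hj⟩, q⟩) i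
  simpa [Matrix.mul_apply, others] using this

theorem star_mulVec_dotProduct_mulVec {m n : Type*} [Fintype m] [Fintype n] (A : Matrix m n ℂ)
    (x y : n → ℂ) : star (A *ᵥ x) ⬝ᵥ (A *ᵥ y) = star x ⬝ᵥ ((Aᴴ * A) *ᵥ y) := by
  rw [star_mulVec, ← dotProduct_mulVec, mulVec_mulVec]

/-- An eigenvector for a nonzero eigenvalue lies in the range of the matrix, hence in the range of
the idempotent `T`. -/
theorem proj_mulVec_eq_self (hu : IsUnit (othersGram h ψ k).det) {x : Fin L → ℂ} {l : ℝ}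
    (hl : l ≠ 0)
    (hx : (proj h ψ k * (h ψ k)ᵀᴴ * (h ψ k)ᵀ * proj h ψ k) *ᵥ x = (l : ℂ) • x) :
    proj h ψ k *ᵥ x = x := by
  have hl' : (l : ℂ) ≠ 0 := by exact_mod_cast hl
  have h1 : proj h ψ k *ᵥ ((l : ℂ) • x) = (l : ℂ) • x := by
    rw [← hx, mulVec_mulVec, ← Matrix.mul_assoc, ← Matrix.mul_assoc, ← Matrix.mul_assoc,
      proj_mul_self hu]
  rw [mulVec_smul] at h1
  exact smul_right_injective _ hl' h1

/-- On the range of `T` the channel `Hᵀ` acts as `Hᵀ T`, and `(Hᵀ T)ᴴ (Hᵀ T)` is the matrix of which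
`y` is an eigenvector. Orthogonal directions therefore stay orthogonal at the receiver. -/
theorem dotProduct_channelT_mulVec {x y : Fin L → ℂ} {l : ℝ}
    (hx : proj h ψ k *ᵥ x = x) (hy : proj h ψ k *ᵥ y = y)
    (hy' : (proj h ψ k * (h ψ k)ᵀᴴ * (h ψ k)ᵀ * proj h ψ k) *ᵥ y = (l : ℂ) • y) :
    star ((h ψ k)ᵀ *ᵥ x) ⬝ᵥ ((h ψ k)ᵀ *ᵥ y) = l * (star x ⬝ᵥ y) := by
  have hT : (proj h ψ k)ᴴ = proj h ψ k := proj_isHermitian h ψ k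
  conv_lhs => rw [← hx, ← hy]
  rw [mulVec_mulVec, mulVec_mulVec, star_mulVec_dotProduct_mulVec, conjTranspose_mul, hT,
    ← Matrix.mul_assoc, hy', dotProduct_smul, smul_eq_mul]

/-- The products `AᴴA` and `AAᴴ` with `A = Hᵀ T` have the same nonzero eigenvalues, and `A` carries
eigenvectors of the first to eigenvectors of the second. -/
theorem effGram_mulVec_of_eigen {x : Fin L → ℂ} {l : ℝ} (hx : proj h ψ k *ᵥ x = x)
    (hx' : (proj h ψ k * (h ψ k)ᵀᴴ * (h ψ k)ᵀ * proj h ψ k) *ᵥ x = (l : ℂ) • x) :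
    effGram h ψ k *ᵥ ((h ψ k)ᵀ *ᵥ x) = (l : ℂ) • ((h ψ k)ᵀ *ᵥ x) := by
  conv_lhs => rw [← hx]
  rw [← mulVec_smul, ← hx', effGram, mulVec_mulVec, mulVec_mulVec, mulVec_mulVec]
  simp only [Matrix.mul_assoc]

theorem star_unit_dotProduct {n : Type*} [Fintype n] (x y : n → ℂ) :
    star (unit x) ⬝ᵥ y = ((‖WithLp.toLp 2 x‖⁻¹ : ℝ) : ℂ) * (star x ⬝ᵥ y) := by
  simp [unit, star_smul, smul_dotProduct]

theorem norm_star_unit_dotProduct_self {n : Type*} [Fintype n] (x : n → ℂ) :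
    ‖star (unit x) ⬝ᵥ x‖ ^ 2 = ‖WithLp.toLp 2 x‖ ^ 2 := by
  rw [star_unit_dotProduct, star_dotProduct_self, ← Complex.ofReal_mul, Complex.norm_real]
  rcases eq_or_ne ‖WithLp.toLp 2 x‖ 0 with h | h
  · simp [h]
  · rw [show ‖WithLp.toLp 2 x‖⁻¹ * ‖WithLp.toLp 2 x‖ ^ 2 = ‖WithLp.toLp 2 x‖ by field_simp]
    simp

theorem star_unit_dotProduct_unit {n : Type*} [Fintype n] {x : n → ℂ} (hx : x ≠ 0) :
    star (unit x) ⬝ᵥ unit x = 1 := by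
  have := norm_toLp_pos hx
  have h1 : (‖WithLp.toLp 2 x‖ : ℂ) ≠ 0 := by exact_mod_cast this.ne'
  rw [star_unit_dotProduct, unit, dotProduct_smul, star_dotProduct_self, smul_eq_mul]
  push_cast
  field_simp

/-- Block diagonalization with maximum ratio combining decouples all the streams. -/
theorem gain_of_isDesign (hu : ∀ ψ k, IsUnit (othersGram h ψ k).det) {m : Directions L M}
    (hm : IsDesign h m) (ψ : Ψ) (k : Fin Q) (q : Fin (M ψ k)) :
    (∀ j, j ≠ k → ∀ p, gain h m ψ k q j p = 0) ∧
    (∀ p, p ≠ q → gain h m ψ k q k p = 0) ∧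
    0 < gain h m ψ k q k q ∧
    ∃ x ≠ 0, effGram h ψ k *ᵥ x = (gain h m ψ k q k q : ℂ) • x := by
  have hproj : ∀ j p, proj h ψ j *ᵥ m ψ j p = m ψ j p := fun j p => by
    obtain ⟨l, hl, he⟩ := (hm ψ j).2.2 p
    exact proj_mulVec_eq_self (hu ψ j) hl he
  have hpre : ∀ j p, precoder h m ψ j p = unit (m ψ j p) := fun j p => by
    rw [precoder, hproj]
  have hprojv : ∀ j p, proj h ψ j *ᵥ precoder h m ψ j p = precoder h m ψ j p := fun j p => by
    rw [hpre, unit, mulVec_smul, hproj]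
  obtain ⟨hne, horth, heig⟩ := hm ψ k
  have heigv : ∀ p, ∃ l : ℝ, l ≠ 0 ∧ (proj h ψ k * (h ψ k)ᵀᴴ * (h ψ k)ᵀ * proj h ψ k) *ᵥ
      precoder h m ψ k p = (l : ℂ) • precoder h m ψ k p := fun p => by
    obtain ⟨l, hl, he⟩ := heig p
    refine ⟨l, hl, ?_⟩
    rw [hpre, unit, mulVec_smul, he, smul_comm]
  refine ⟨fun j hj p => ?_, fun p hp => ?_, ?_⟩
  -- The precoder of user `j` lies in the range of its projection, which is annihilated by the
  -- channels of the other users, in particular of `k`.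
  · have : (h ψ k)ᵀ *ᵥ precoder h m ψ j p = 0 := by
      rw [← hprojv, mulVec_mulVec, channelT_mul_proj_of_ne (hu ψ j) hj.symm, zero_mulVec]
    simp [gain, this]
  · obtain ⟨l, hl, he⟩ := heigv p
    have h1 := dotProduct_channelT_mulVec (hprojv k q) (hprojv k p) he
    have h2 : star (precoder h m ψ k q) ⬝ᵥ precoder h m ψ k p = 0 := by
      rw [hpre, hpre, star_unit_dotProduct, unit, dotProduct_smul, horth q p hp.symm]
      simp
    rw [h2, mul_zero] at h1
    simp [gain, combiner, star_unit_dotProduct, h1]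
  · obtain ⟨l, hl, he⟩ := heigv q
    have h1 := dotProduct_channelT_mulVec (hprojv k q) (hprojv k q) he
    have h2 : star (precoder h m ψ k q) ⬝ᵥ precoder h m ψ k q = 1 := by
      rw [hpre]; exact star_unit_dotProduct_unit (hne q)
    rw [h2, mul_one] at h1
    have h3 : gain h m ψ k q k q = l := by
      rw [gain, combiner, norm_star_unit_dotProduct_self]
      rw [star_dotProduct_self] at h1
      exact_mod_cast h1
    have h4 : (h ψ k)ᵀ *ᵥ precoder h m ψ k q ≠ 0 := by
      intro h0
      rw [h0] at h1
      simp at h1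
      exact hl (by exact_mod_cast h1.symm)
    refine ⟨lt_of_le_of_ne (by rw [gain]; positivity) (by rw [h3]; exact hl.symm), _, h4, ?_⟩
    rw [h3]
    exact effGram_mulVec_of_eigen (hprojv k q) he

theorem sinr_of_isDesign (hu : ∀ ψ k, IsUnit (othersGram h ψ k).det) {m : Directions L M}
    (hm : IsDesign h m) (N₀ : ℝ) (P : Powers M) (ψ : Ψ) (k : Fin Q) (q : Fin (M ψ k)) :
    sinr N₀ h m P ψ k q = P ψ k q * gain h m ψ k q k q / N₀ := by
  obtain ⟨h1, h2, -⟩ := gain_of_isDesign hu hm ψ k q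
  rw [sinr, Finset.sum_eq_zero fun p hp => by rw [h2 p (Finset.ne_of_mem_erase hp), mul_zero],
    Finset.sum_eq_zero fun j hj => Finset.sum_eq_zero fun p _ => by
      rw [h1 j (Finset.ne_of_mem_erase hj), mul_zero], add_zero, add_zero]

/-- Take `m = T H* x` with `x` running through an orthonormal eigenbasis of `Hᵀ T H*`. The squared
norm of `m` is then the eigenvalue, so nonzero eigenvalues give nonzero directions. -/
theorem exists_isDesign (hu : ∀ ψ k, IsUnit (othersGram h ψ k).det)
    (he : ∀ ψ k q, eigval h ψ k q ≠ 0) : ∃ m : Directions L M, IsDesign h m := by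
  set x : ∀ ψ k, Fin (M ψ k) → Fin (M ψ k) → ℂ := fun ψ k q =>
    ⇑((effGram_isHermitian h ψ k).eigenvectorBasis q) with hx
  have hex : ∀ ψ k q, effGram h ψ k *ᵥ x ψ k q = (eigval h ψ k q : ℂ) • x ψ k q := fun ψ k q => by
    have := (effGram_isHermitian h ψ k).mulVec_eigenvectorBasis q
    rw [hx, this]
    ext i
    simp [eigval]
  have hdot : ∀ ψ k p q, star (x ψ k p) ⬝ᵥ x ψ k q = if p = q then 1 else 0 := fun ψ k p q => by
    have h1 := orthonormal_iff_ite.1 (effGram_isHermitian h ψ k).eigenvectorBasis.orthonormal p q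
    rw [EuclideanSpace.inner_eq_star_dotProduct, dotProduct_comm] at h1
    exact h1
  set m : Directions L M := fun ψ k q => (proj h ψ k * (h ψ k)ᵀᴴ) *ᵥ x ψ k q with hm
  have hmdot : ∀ ψ k p q, star (m ψ k p) ⬝ᵥ m ψ k q =
      eigval h ψ k q * (if p = q then 1 else 0) := fun ψ k p q => by
    have hT : (proj h ψ k)ᴴ = proj h ψ k := proj_isHermitian h ψ k
    rw [hm, star_mulVec_dotProduct_mulVec, conjTranspose_mul, hT, conjTranspose_conjTranspose,
      Matrix.mul_assoc, ← Matrix.mul_assoc (proj h ψ k), proj_mul_self (hu ψ k), ← Matrix.mul_assoc,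
      ← effGram, hex, dotProduct_smul, hdot, smul_eq_mul]
  refine ⟨m, fun ψ k => ⟨fun q h0 => ?_, fun p q hpq => ?_, fun q => ⟨_, he ψ k q, ?_⟩⟩⟩
  · have := hmdot ψ k q q
    rw [h0] at this
    simp at this
    exact he ψ k q (by exact_mod_cast this.symm)
  · rw [hmdot, if_neg hpq, mul_zero]
  · rw [hm, mulVec_mulVec, ← mulVec_smul, ← hex, mulVec_mulVec, effGram]
    congr 1
    simp only [Matrix.mul_assoc]
    rw [← Matrix.mul_assoc (proj h ψ k) (proj h ψ k), proj_mul_self (hu ψ k)]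

theorem exists_eigvec_eigval (h : Channel L M) (ψ : Ψ) (k : Fin Q) (q : Fin (M ψ k)) :
    ∃ x ≠ 0, effGram h ψ k *ᵥ x = (eigval h ψ k q : ℂ) • x := by
  refine ⟨⇑((effGram_isHermitian h ψ k).eigenvectorBasis q), ?_, ?_⟩
  · intro h0
    have h1 := (effGram_isHermitian h ψ k).eigenvectorBasis.orthonormal.ne_zero q
    exact h1 (by ext i; exact congrFun h0 i)
  · rw [(effGram_isHermitian h ψ k).mulVec_eigenvectorBasis q]
    ext i
    simp [eigval]

theorem rank_effGram_of_eigval_ne_zero (he : ∀ q, eigval h ψ k q ≠ 0) :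
    (effGram h ψ k).rank = M ψ k := by
  rw [(effGram_isHermitian h ψ k).rank_eq_card_non_zero_eigs]
  have : ∀ q, (effGram_isHermitian h ψ k).eigenvalues q ≠ 0 := he
  rw [Fintype.card_congr (Equiv.subtypeUnivEquiv this), Fintype.card_fin]

end Algebra

/-! ### Limits of the effective matrices and their eigenvalues -/

section Convergence

variable {Ψ : Type*} {Q : ℕ} {M : Ψ → Fin Q → ℕ} {β : Ψ → Fin Q → ℝ}

/-- The normalized inner products of the channel columns within a group converge to those of
orthogonal columns with squared norms `β`. -/
def GramConverges (β : Ψ → Fin Q → ℝ) (h : ∀ L : ℕ, Channel L M) : Prop :=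
  ∀ (ψ : Ψ) (c d : Σ k, Fin (M ψ k)),
    Tendsto (fun L : ℕ => (∑ i, h L ψ c.1 i c.2 * star (h L ψ d.1 i d.2)) / (L : ℂ))
      atTop (𝓝 (if c = d then (β ψ c.1 : ℂ) else 0))

theorem tendsto_matrix {m n X : Type*} {l : Filter X} {A : X → Matrix m n ℂ} {B : Matrix m n ℂ}
    (h : ∀ i j, Tendsto (fun x => A x i j) l (𝓝 (B i j))) : Tendsto A l (𝓝 B) :=
  tendsto_pi_nhds.2 fun i => tendsto_pi_nhds.2 fun j => h i j

theorem tendsto_matrix_mul {l m n X : Type*} [Fintype m] {f : Filter X} {A : X → Matrix l m ℂ}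
    {B : X → Matrix m n ℂ} {A₀ : Matrix l m ℂ} {B₀ : Matrix m n ℂ} (hA : Tendsto A f (𝓝 A₀))
    (hB : Tendsto B f (𝓝 B₀)) : Tendsto (fun x => A x * B x) f (𝓝 (A₀ * B₀)) :=
  tendsto_matrix fun i j => tendsto_finsetSum Finset.univ fun k _ =>
    (tendsto_pi_nhds.1 (tendsto_pi_nhds.1 hA i) k).mul
      (tendsto_pi_nhds.1 (tendsto_pi_nhds.1 hB k) j)

variable {h : ∀ L : ℕ, Channel L M}

theorem GramConverges.tendsto_othersGram (hh : GramConverges β h) (ψ : Ψ) (k : Fin Q) :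
    Tendsto (fun L : ℕ => ((L : ℂ)⁻¹) • othersGram (h L) ψ k) atTop
      (𝓝 (diagonal fun x => (β ψ x.1 : ℂ))) := by
  refine tendsto_matrix fun x y => ?_
  have := hh ψ ⟨x.1, x.2⟩ ⟨y.1, y.2⟩
  convert this using 2
  · simp [othersGram, Matrix.mul_apply, others, div_eq_inv_mul]
  · rw [diagonal_apply]
    refine if_congr ?_ rfl rfl
    obtain ⟨⟨a, ha⟩, b⟩ := x
    obtain ⟨⟨c, hc⟩, d⟩ := y
    constructor
    · intro e; cases e; rfl
    · intro e; cases e; rfl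

/-- With `A` the channels of the other users, `Hᵀ T H*` is the Schur complement `HᵀH* - HᵀA*
(AᵀA*)⁻¹ AᵀH*`. After division by `L` both cross blocks tend to `0`, while the inverted block tends
to the inverse of an invertible diagonal matrix, which also yields the invertibility for large `L`.
-/
theorem GramConverges.tendsto_effGram (hh : GramConverges β h) (hβ : ∀ ψ k, 0 < β ψ k) (ψ : Ψ)
    (k : Fin Q) :
    (∀ᶠ L : ℕ in atTop, IsUnit (othersGram (h L) ψ k).det) ∧
    Tendsto (fun L : ℕ => ((L : ℂ)⁻¹) • effGram (h L) ψ k) atTop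
      (𝓝 ((β ψ k : ℂ) • (1 : Matrix (Fin (M ψ k)) (Fin (M ψ k)) ℂ))) := by
  have hA := hh.tendsto_othersGram ψ k
  set D : Matrix (Σ j : {j : Fin Q // j ≠ k}, Fin (M ψ j)) (Σ j : {j : Fin Q // j ≠ k}, Fin (M ψ j)) ℂ :=
    diagonal fun x => (β ψ x.1 : ℂ) with hD
  have hDdet : D.det ≠ 0 := by
    rw [hD, det_diagonal, Finset.prod_ne_zero_iff]
    intro x _
    exact_mod_cast (hβ ψ x.1).ne'
  have hdet : Tendsto (fun L : ℕ => (((L : ℂ)⁻¹) • othersGram (h L) ψ k).det) atTop (𝓝 D.det) :=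
    ((continuous_id.matrix_det).tendsto D).comp hA
  have hunit : ∀ᶠ L : ℕ in atTop, IsUnit (othersGram (h L) ψ k).det := by
    filter_upwards [hdet.eventually_ne hDdet] with L hL
    rw [det_smul] at hL
    exact (right_ne_zero_of_mul hL).isUnit
  refine ⟨hunit, ?_⟩
  have hinv : Tendsto (fun L : ℕ => (((L : ℂ)⁻¹) • othersGram (h L) ψ k)⁻¹) atTop (𝓝 D⁻¹) := by
    have hc : ContinuousAt Inv.inv D := continuousAt_matrix_inv D (by
      rw [Ring.inverse_eq_inv']
      exact continuousAt_inv₀ hDdet)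
    exact hc.tendsto.comp hA
  have hB : Tendsto (fun L : ℕ => ((L : ℂ)⁻¹) • ((h L ψ k)ᵀ * (h L ψ k)ᵀᴴ)) atTop
      (𝓝 ((β ψ k : ℂ) • (1 : Matrix (Fin (M ψ k)) (Fin (M ψ k)) ℂ))) := by
    refine tendsto_matrix fun p q => ?_
    have := hh ψ ⟨k, p⟩ ⟨k, q⟩
    convert this using 2
    · simp [Matrix.mul_apply, div_eq_inv_mul]
    · rw [Matrix.smul_apply, one_apply]
      by_cases hpq : p = q <;> simp [hpq]
  have hBA : Tendsto (fun L : ℕ => ((L : ℂ)⁻¹) • ((h L ψ k)ᵀ * (others (h L) ψ k)ᵀᴴ)) atTop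
      (𝓝 0) := by
    refine tendsto_matrix fun p y => ?_
    have := hh ψ ⟨k, p⟩ ⟨y.1, y.2⟩
    rw [if_neg (by intro e; exact y.1.2 (congrArg Sigma.fst e).symm)] at this
    simpa [Matrix.mul_apply, others, div_eq_inv_mul] using this
  have hAB : Tendsto (fun L : ℕ => ((L : ℂ)⁻¹) • ((others (h L) ψ k)ᵀ * (h L ψ k)ᵀᴴ)) atTop
      (𝓝 0) := by
    refine tendsto_matrix fun x q => ?_
    have := hh ψ ⟨x.1, x.2⟩ ⟨k, q⟩
    rw [if_neg (by intro e; exact x.1.2 (congrArg Sigma.fst e))] at this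
    simpa [Matrix.mul_apply, others, div_eq_inv_mul] using this
  have hlim := hB.sub (tendsto_matrix_mul (tendsto_matrix_mul hBA hinv) hAB)
  simp only [Matrix.mul_zero, sub_zero] at hlim
  refine hlim.congr' ?_
  filter_upwards [hunit, eventually_gt_atTop 0] with L hu hL
  have hL' : (L : ℂ) ≠ 0 := by exact_mod_cast hL.ne'
  have e1 : (((L : ℂ)⁻¹) • othersGram (h L) ψ k)⁻¹ = (L : ℂ) • (othersGram (h L) ψ k)⁻¹ := by
    apply inv_eq_left_inv
    rw [smul_mul_smul_comm, mul_inv_cancel₀ hL', one_smul, nonsing_inv_mul _ hu]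
  simp only [e1, Matrix.mul_smul, Matrix.smul_mul]
  rw [smul_smul (L : ℂ), mul_inv_cancel₀ hL', one_smul, ← smul_sub]
  congr 1
  rw [effGram, proj, ← othersGram, Matrix.mul_sub, Matrix.sub_mul, Matrix.mul_one]
  simp only [Matrix.mul_assoc]

/-- Read the eigenvalue equation in a row where the eigenvector has an entry of largest modulus. -/
theorem norm_eigenvalue_le_sum {n : Type*} [Fintype n] {A : Matrix n n ℂ} {x : n → ℂ} (hx : x ≠ 0)
    {c : ℂ} (h : A *ᵥ x = c • x) : ‖c‖ ≤ ∑ i, ∑ j, ‖A i j‖ := by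
  obtain ⟨j₀, hj₀⟩ := Function.ne_iff.1 hx
  obtain ⟨i, -, hi⟩ := Finset.exists_max_image Finset.univ (fun i => ‖x i‖) ⟨j₀, Finset.mem_univ _⟩
  have hpos : 0 < ‖x i‖ := (norm_pos_iff.2 hj₀).trans_le (hi j₀ (Finset.mem_univ _))
  have h1 : ‖c‖ * ‖x i‖ ≤ (∑ j, ‖A i j‖) * ‖x i‖ := by
    rw [← norm_mul, ← smul_eq_mul, ← Pi.smul_apply, ← h, Finset.sum_mul]
    refine (norm_sum_le _ _).trans (Finset.sum_le_sum fun j _ => ?_)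
    rw [norm_mul]
    exact mul_le_mul_of_nonneg_left (hi j (Finset.mem_univ _)) (norm_nonneg _)
  refine (le_of_mul_le_mul_right h1 hpos).trans ?_
  exact Finset.single_le_sum (f := fun i => ∑ j, ‖A i j‖)
    (fun i _ => Finset.sum_nonneg fun j _ => norm_nonneg _) (Finset.mem_univ i)

theorem tendsto_detEig_div (M : Ψ → Fin Q → ℕ) (β : Ψ → Fin Q → ℝ) (ψ : Ψ) (k : Fin Q) :
    Tendsto (fun L : ℕ => detEig M β L ψ k / L) atTop (𝓝 (β ψ k)) := by
  have h1 : Tendsto (fun L : ℕ => β ψ k * (1 + ((M ψ k : ℝ) - groupAntennas M ψ) / L)) atTop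
      (𝓝 (β ψ k * (1 + 0))) :=
    ((tendsto_const_div_atTop_nhds_zero_nat _).const_add 1).const_mul _
  rw [add_zero, mul_one] at h1
  refine h1.congr' ?_
  filter_upwards [eventually_gt_atTop 0] with L hL
  have hL' : (L : ℝ) ≠ 0 := by exact_mod_cast hL.ne'
  rw [detEig]
  field_simp
  ring

/-- The number `l / L - β` is an eigenvalue of a matrix whose entries tend to zero. Any sequence of
eigenvalues is allowed, so that the statement covers both `eigval` and the gains of an arbitrary
design. -/
theorem GramConverges.tendsto_eigenvalue (hh : GramConverges β h) (hβ : ∀ ψ k, 0 < β ψ k) (ψ : Ψ)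
    (k : Fin Q) {l : ℕ → ℝ}
    (hl : ∀ᶠ L : ℕ in atTop, ∃ x ≠ 0, effGram (h L) ψ k *ᵥ x = (l L : ℂ) • x) :
    Tendsto (fun L : ℕ => l L / detEig M β L ψ k) atTop (𝓝 1) := by
  have h1 := (hh.tendsto_effGram hβ ψ k).2
  have h2 : Tendsto (fun L : ℕ => ∑ i, ∑ j, ‖(((L : ℂ)⁻¹) • effGram (h L) ψ k -
      (β ψ k : ℂ) • (1 : Matrix (Fin (M ψ k)) (Fin (M ψ k)) ℂ)) i j‖) atTop (𝓝 0) := by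
    have h3 := h1.sub_const ((β ψ k : ℂ) • (1 : Matrix (Fin (M ψ k)) (Fin (M ψ k)) ℂ))
    rw [sub_self] at h3
    have := tendsto_finsetSum Finset.univ fun i _ => tendsto_finsetSum Finset.univ fun j _ =>
      ((tendsto_pi_nhds.1 (tendsto_pi_nhds.1 h3 i) j).norm)
    simpa using this
  have h4 : Tendsto (fun L : ℕ => l L / L - β ψ k) atTop (𝓝 0) := by
    refine squeeze_zero_norm' ?_ h2
    filter_upwards [hl] with L ⟨x, hx, he⟩
    have h5 : (((L : ℂ)⁻¹) • effGram (h L) ψ k -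
        (β ψ k : ℂ) • (1 : Matrix (Fin (M ψ k)) (Fin (M ψ k)) ℂ)) *ᵥ x =
        ((l L / L - β ψ k : ℝ) : ℂ) • x := by
      rw [sub_mulVec, smul_mulVec, he, smul_mulVec, one_mulVec, smul_smul, ← sub_smul]
      congr 1
      push_cast
      ring
    have h6 := norm_eigenvalue_le_sum hx h5
    rwa [Complex.norm_real] at h6
  have h7 : Tendsto (fun L : ℕ => l L / L) atTop (𝓝 (β ψ k)) := by
    simpa using h4.add_const (β ψ k)
  have h8 := h7.div (tendsto_detEig_div M β ψ k) (hβ ψ k).ne'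
  rw [div_self (hβ ψ k).ne'] at h8
  refine h8.congr' ?_
  filter_upwards [eventually_gt_atTop 0] with L hL
  have hL' : (L : ℝ) ≠ 0 := by exact_mod_cast hL.ne'
  simp only [Pi.div_apply]
  field_simp

theorem tendsto_detEig_atTop {M : Ψ → Fin Q → ℕ} (hβ : ∀ ψ k, 0 < β ψ k) (ψ : Ψ) (k : Fin Q) :
    Tendsto (fun L : ℕ => detEig M β L ψ k) atTop atTop := by
  have h1 : Tendsto (fun L : ℕ => ((L : ℝ) - (groupAntennas M ψ : ℝ) + (M ψ k : ℝ))) atTop atTop :=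
    tendsto_atTop_add_const_right _ _
      (tendsto_atTop_add_const_right _ _ tendsto_natCast_atTop_atTop)
  exact h1.const_mul_atTop (hβ ψ k)

end Convergence

theorem ae_gramConverges {Ψ : Type*} [Countable Ψ] {Q : ℕ} {M : Ψ → Fin Q → ℕ}
    {β : Ψ → Fin Q → ℝ} (hβ : ∀ ψ k, 0 < β ψ k)
    {Ω : Type*} [MeasurableSpace Ω] {μ : Measure Ω} [IsProbabilityMeasure μ]
    {H : ∀ L : ℕ, Ω → Channel L M} (hH : ∀ L : ℕ, IsRayleigh μ β (H L)) :
    ∀ᵐ ω ∂μ, GramConverges β (fun L => H L ω) :=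
  ae_all_iff.2 fun ψ => ae_all_iff.2 fun c => ae_all_iff.2 fun d => ae_tendsto_gram_entry hβ hH ψ c d

theorem detEig_pos {Ψ : Type*} {Q : ℕ} {M : Ψ → Fin Q → ℕ} {β : Ψ → Fin Q → ℝ}
    (hβ : ∀ ψ k, 0 < β ψ k) {L : ℕ} {ψ : Ψ} {k : Fin Q}
    (h : groupAntennas M ψ < L + M ψ k) : 0 < detEig M β L ψ k := by
  have h1 : (groupAntennas M ψ : ℝ) < L + M ψ k := by exact_mod_cast h
  exact mul_pos (hβ ψ k) (by linarith)

/-! ### The exponential-sum equation -/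

section ExpEq

variable {Ψ : Type*} [Fintype Ψ] {Q : ℕ} {M : Ψ → Fin Q → ℕ} {β : Ψ → Fin Q → ℝ}
  {N₀ Ptot Θ T : ℝ}

theorem numUsers_pos (Ψ : Type*) [Fintype Ψ] [Nonempty Ψ] {Q : ℕ} (hQ : 0 < Q) :
    0 < numUsers Ψ Q :=
  mul_pos (by exact_mod_cast Fintype.card_pos) (by exact_mod_cast hQ)

/-- The total power as a function of the rate parameter. -/
noncomputable def powerOfRate (Θ T N₀ : ℝ) (M : Ψ → Fin Q → ℕ) (β : Ψ → Fin Q → ℝ) (L : ℕ) (R : ℝ) : ℝ :=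
  ∑ ψ, ∑ k, N₀ * (M ψ k : ℝ) *
      (Real.exp (R / (csiFactor M Θ T * (M ψ k : ℝ) * numUsers Ψ Q)) - 1) / detEig M β L ψ k

theorem strictMono_powerOfRate [Nonempty Ψ] (hQ : 0 < Q) (hM : ∀ ψ k, 0 < M ψ k) (hN₀ : 0 < N₀)
    (hξ : 0 < csiFactor M Θ T) {L : ℕ} (hD : ∀ ψ k, 0 < detEig M β L ψ k) :
    StrictMono (powerOfRate Θ T N₀ M β L) := by
  intro R S hRS
  have : Nonempty (Fin Q) := ⟨⟨0, hQ⟩⟩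
  refine Finset.sum_lt_sum_of_nonempty Finset.univ_nonempty fun ψ _ =>
    Finset.sum_lt_sum_of_nonempty Finset.univ_nonempty fun k _ => ?_
  have h1 := hD ψ k
  have h2 : (0 : ℝ) < M ψ k := by exact_mod_cast hM ψ k
  have h3 := numUsers_pos Ψ hQ
  gcongr

theorem powerOfRate_zero (Θ T N₀ : ℝ) (M : Ψ → Fin Q → ℕ) (β : Ψ → Fin Q → ℝ) (L : ℕ) :
    powerOfRate Θ T N₀ M β L 0 = 0 := by
  simp [powerOfRate]

theorem existsUnique_solvesExpEq [Nonempty Ψ] (hQ : 0 < Q) (hM : ∀ ψ k, 0 < M ψ k) (hN₀ : 0 < N₀)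
    (hPtot : 0 < Ptot) (hξ : 0 < csiFactor M Θ T) {L : ℕ} (hD : ∀ ψ k, 0 < detEig M β L ψ k) :
    ∃! R : ℝ, SolvesExpEq Θ T N₀ Ptot M β L R := by
  have hmono := strictMono_powerOfRate hQ hM hN₀ hξ hD
  have hcont : Continuous (powerOfRate Θ T N₀ M β L) := by
    unfold powerOfRate
    fun_prop
  have hN := numUsers_pos Ψ hQ
  have hQ' : Nonempty (Fin Q) := ⟨⟨0, hQ⟩⟩
  obtain ⟨ψ⟩ := ‹Nonempty Ψ›
  obtain ⟨k⟩ := hQ'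
  have hM' : ∀ ψ k, (0 : ℝ) < M ψ k := fun ψ k => by exact_mod_cast hM ψ k
  set a := csiFactor M Θ T * (M ψ k : ℝ) * numUsers Ψ Q with ha
  have hapos : 0 < a := mul_pos (mul_pos hξ (hM' ψ k)) hN
  -- At this `R` a single summand already reaches `Ptot`, because `exp x - 1 ≥ x`; this is the upper
  -- end for the intermediate value theorem.
  set R := a * (Ptot * detEig M β L ψ k / (N₀ * M ψ k)) with hR
  have hquot : 0 < Ptot * detEig M β L ψ k / (N₀ * M ψ k) :=
    div_pos (mul_pos hPtot (hD ψ k)) (mul_pos hN₀ (hM' ψ k))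
  have hRpos : 0 < R := mul_pos hapos hquot
  have hterm : ∀ ψ k, 0 ≤ N₀ * (M ψ k : ℝ) *
      (Real.exp (R / (csiFactor M Θ T * (M ψ k : ℝ) * numUsers Ψ Q)) - 1) / detEig M β L ψ k := by
    intro ψ k
    have h1 : 1 ≤ Real.exp (R / (csiFactor M Θ T * (M ψ k : ℝ) * numUsers Ψ Q)) :=
      Real.one_le_exp (div_nonneg hRpos.le (mul_pos (mul_pos hξ (hM' ψ k)) hN).le)
    exact div_nonneg (mul_nonneg (mul_pos hN₀ (hM' ψ k)).le (by linarith)) (hD ψ k).le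
  have hge : Ptot ≤ powerOfRate Θ T N₀ M β L R := by
    have h1 : Ptot ≤ N₀ * (M ψ k : ℝ) * (Real.exp (R / a) - 1) / detEig M β L ψ k := by
      rw [le_div_iff₀ (hD ψ k)]
      have h2 : R / a = Ptot * detEig M β L ψ k / (N₀ * M ψ k) := by rw [hR]; field_simp
      have h3 := Real.add_one_le_exp (R / a)
      calc Ptot * detEig M β L ψ k = N₀ * M ψ k * (R / a) := by
            rw [h2]
            have := (hM' ψ k).ne'
            field_simp
        _ ≤ _ := mul_le_mul_of_nonneg_left (by linarith) (mul_pos hN₀ (hM' ψ k)).le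
    refine h1.trans ?_
    refine (Finset.single_le_sum (f := fun k => N₀ * (M ψ k : ℝ) *
      (Real.exp (R / (csiFactor M Θ T * (M ψ k : ℝ) * numUsers Ψ Q)) - 1) / detEig M β L ψ k)
      (fun k _ => hterm ψ k) (Finset.mem_univ k)).trans ?_
    exact Finset.single_le_sum (f := fun ψ => ∑ k, N₀ * (M ψ k : ℝ) *
      (Real.exp (R / (csiFactor M Θ T * (M ψ k : ℝ) * numUsers Ψ Q)) - 1) / detEig M β L ψ k)
      (fun ψ _ => Finset.sum_nonneg fun k _ => hterm ψ k) (Finset.mem_univ ψ)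
  obtain ⟨S, -, hS⟩ := intermediate_value_Icc hRpos.le hcont.continuousOn
    ⟨(powerOfRate_zero Θ T N₀ M β L).le.trans hPtot.le, hge⟩
  exact ⟨S, hS, fun S' hS' => hmono.injective (Eq.trans hS' hS.symm)⟩

theorem SolvesExpEq.pos [Nonempty Ψ] (hQ : 0 < Q) (hM : ∀ ψ k, 0 < M ψ k) (hN₀ : 0 < N₀)
    (hPtot : 0 < Ptot) (hξ : 0 < csiFactor M Θ T) {L : ℕ} (hD : ∀ ψ k, 0 < detEig M β L ψ k)
    {R : ℝ} (hR : SolvesExpEq Θ T N₀ Ptot M β L R) : 0 < R := by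
  refine (strictMono_powerOfRate hQ hM hN₀ hξ hD).lt_iff_lt.1 ?_
  rw [powerOfRate_zero]
  exact hPtot.trans_eq (Eq.symm hR)

/-- With equal antenna numbers all exponents coincide and `detEig` is `β` times a common factor, so
the equation is linear in the one exponential. -/
theorem solvesExpEq_closedForm [Nonempty Ψ] (hQ : 0 < Q) (hM : ∀ ψ k, 0 < M ψ k)
    (hβ : ∀ ψ k, 0 < β ψ k) (hN₀ : 0 < N₀)
    (hPtot : 0 < Ptot) (hξ : 0 < csiFactor M Θ T) {L : ℕ} (hD : ∀ ψ k, 0 < detEig M β L ψ k)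
    {M₀ : ℕ} (hM₀ : ∀ ψ k, M ψ k = M₀) :
    SolvesExpEq Θ T N₀ Ptot M β L (closedForm Θ T N₀ Ptot M β M₀ L) := by
  have hQ' : Nonempty (Fin Q) := ⟨⟨0, hQ⟩⟩
  have hM' : (0 : ℝ) < M₀ := by
    obtain ⟨ψ⟩ := ‹Nonempty Ψ›
    obtain ⟨k⟩ := hQ'
    exact_mod_cast hM₀ ψ k ▸ hM ψ k
  have hN := numUsers_pos Ψ hQ
  have hDeq : ∀ ψ k, detEig M β L ψ k = β ψ k * ((L : ℝ) - ((Q : ℝ) - 1) * M₀) := fun ψ k => by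
    rw [detEig, groupAntennas, hM₀ ψ k, Finset.sum_congr rfl fun k _ => hM₀ ψ k]
    simp only [Finset.sum_const, Finset.card_univ, Fintype.card_fin, smul_eq_mul]
    push_cast
    ring
  have hLpos : 0 < (L : ℝ) - ((Q : ℝ) - 1) * M₀ := by
    obtain ⟨ψ⟩ := ‹Nonempty Ψ›
    obtain ⟨k⟩ := hQ'
    have := hD ψ k
    rw [hDeq] at this
    exact (mul_pos_iff_of_pos_left (hβ ψ k)).1 this
  have hsum : 0 < ∑ ψ, ∑ k, (β ψ k)⁻¹ :=
    Finset.sum_pos (fun ψ _ => Finset.sum_pos (fun k _ => inv_pos.2 (hβ ψ k)) Finset.univ_nonempty)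
      Finset.univ_nonempty
  set Λ := (L : ℝ) - ((Q : ℝ) - 1) * M₀ with hΛ
  set B := ∑ ψ, ∑ k, (β ψ k)⁻¹ with hB
  have hexp : Real.exp (closedForm Θ T N₀ Ptot M β M₀ L /
      (csiFactor M Θ T * (M₀ : ℝ) * numUsers Ψ Q)) = 1 + Ptot * Λ / (N₀ * M₀ * B) := by
    rw [closedForm, show csiFactor M Θ T * numUsers Ψ Q * (M₀ : ℝ) =
      csiFactor M Θ T * (M₀ : ℝ) * numUsers Ψ Q by ring, mul_div_cancel_left₀ _ (by positivity),
      Real.exp_log (by positivity)]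
  have hterm : ∀ ψ k, N₀ * (M ψ k : ℝ) *
      (Real.exp (closedForm Θ T N₀ Ptot M β M₀ L /
        (csiFactor M Θ T * (M ψ k : ℝ) * numUsers Ψ Q)) - 1) / detEig M β L ψ k =
      Ptot / B * (β ψ k)⁻¹ := fun ψ k => by
    rw [hM₀ ψ k, hexp, hDeq]
    have := (hβ ψ k).ne'
    field_simp
    ring
  rw [SolvesExpEq, Finset.sum_congr rfl fun ψ _ => Finset.sum_congr rfl fun k _ => hterm ψ k]
  simp_rw [← Finset.mul_sum]
  rw [← hB, div_mul_cancel₀ _ hsum.ne']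

theorem eventually_detEig_pos (hβ : ∀ ψ k, 0 < β ψ k) :
    ∀ᶠ L : ℕ in atTop, ∀ ψ k, 0 < detEig M β L ψ k :=
  eventually_all.2 fun ψ => eventually_all.2 fun k =>
    (tendsto_detEig_atTop hβ ψ k).eventually_gt_atTop 0

/-- For any fixed rate `b` the required power tends to `0`, so it eventually falls below `Ptot`;
monotonicity then puts the solution above `b`. -/
theorem tendsto_solution_atTop [Nonempty Ψ] (hQ : 0 < Q) (hM : ∀ ψ k, 0 < M ψ k)
    (hβ : ∀ ψ k, 0 < β ψ k) (hN₀ : 0 < N₀) (hPtot : 0 < Ptot) (hξ : 0 < csiFactor M Θ T)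
    {R : ℕ → ℝ} (hR : ∀ᶠ L : ℕ in atTop, SolvesExpEq Θ T N₀ Ptot M β L (R L)) :
    Tendsto R atTop atTop := by
  refine tendsto_atTop.2 fun b => ?_
  have h1 : Tendsto (fun L : ℕ => powerOfRate Θ T N₀ M β L b) atTop (𝓝 0) := by
    have := tendsto_finsetSum Finset.univ fun (ψ : Ψ) _ =>
      tendsto_finsetSum Finset.univ fun (k : Fin Q) _ =>
      (tendsto_detEig_atTop (M := M) hβ ψ k).const_div_atTop (N₀ * (M ψ k : ℝ) *
      (Real.exp (b / (csiFactor M Θ T * (M ψ k : ℝ) * numUsers Ψ Q)) - 1))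
    simpa [powerOfRate] using this
  filter_upwards [hR, eventually_detEig_pos (M := M) hβ, h1.eventually_lt_const hPtot] with L hL hD hb
  refine ((strictMono_powerOfRate hQ hM hN₀ hξ hD).lt_iff_lt.1 ?_).le
  exact hb.trans_eq (Eq.symm hL)

theorem detPower_pos (hM : ∀ ψ k, 0 < M ψ k) (hQ : 0 < Q) [Nonempty Ψ] (hN₀ : 0 < N₀)
    (hξ : 0 < csiFactor M Θ T) {L : ℕ}
    (hD : ∀ ψ k, 0 < detEig M β L ψ k) {R : ℝ} (hR : 0 < R) (ψ : Ψ) (k : Fin Q)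
    (q : Fin (M ψ k)) : 0 < detPower Θ T N₀ M β L R ψ k q := by
  have hM' : (0 : ℝ) < M ψ k := by exact_mod_cast hM ψ k
  have := numUsers_pos Ψ hQ
  have h1 : 1 < Real.exp (R / (csiFactor M Θ T * (M ψ k : ℝ) * numUsers Ψ Q)) :=
    Real.one_lt_exp_iff.2 (by positivity)
  exact div_pos (mul_pos hN₀ (by linarith)) (hD ψ k)

theorem totalPower_detPower {L : ℕ} {R : ℝ} (hR : SolvesExpEq Θ T N₀ Ptot M β L R) :
    totalPower (detPower Θ T N₀ M β L R) = Ptot := by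
  rw [← show _ = Ptot from hR, totalPower]
  refine Finset.sum_congr rfl fun ψ _ => Finset.sum_congr rfl fun k _ => ?_
  simp only [detPower, Finset.sum_const, Finset.card_univ, Fintype.card_fin, nsmul_eq_mul]
  ring

end ExpEq

/-! ### Max-min fairness over decoupled streams, for fixed `L` -/

section GainsClose

variable {Ψ : Type*} {Q : ℕ} {M : Ψ → Fin Q → ℕ} {β : Ψ → Fin Q → ℝ} {N₀ : ℝ} {L : ℕ}
  {g P : Powers M}

/-- All gains agree with the deterministic ones up to the factor `κ`. -/
structure GainsClose (κ : ℝ) (β : Ψ → Fin Q → ℝ) (L : ℕ) (g : Powers M) : Prop where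
  one_le : 1 ≤ κ
  upper : ∀ ψ k q, g ψ k q ≤ κ * detEig M β L ψ k
  lower : ∀ ψ k q, detEig M β L ψ k ≤ κ * g ψ k q

theorem GainsClose.sum_one_add_le {κ : ℝ} (hκ : GainsClose κ β L g) (hN₀ : 0 < N₀)
    (hP : ∀ ψ k q, 0 ≤ P ψ k q) (ψ : Ψ) (k : Fin Q) :
    ∑ q, (1 + P ψ k q * g ψ k q / N₀) ≤
      M ψ k + κ * detEig M β L ψ k * (∑ q, P ψ k q) / N₀ := by
  rw [Finset.sum_add_distrib, Finset.mul_sum, Finset.sum_div]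
  simp only [Finset.sum_const, Finset.card_univ, Fintype.card_fin, nsmul_eq_mul, mul_one]
  refine add_le_add_right (Finset.sum_le_sum fun q _ => ?_) _
  rw [mul_comm (P ψ k q)]
  have := hP ψ k q
  have := hκ.upper ψ k q
  gcongr

end GainsClose

section Optimization

variable {Ψ : Type*} [Fintype Ψ] {Q : ℕ} {M : Ψ → Fin Q → ℕ} {β : Ψ → Fin Q → ℝ}
  {N₀ Ptot Θ T : ℝ} {L : ℕ} {h : Channel L M} {m : Directions L M} {g P : Powers M}

/-- The streams are decoupled, with gains `g`. -/
structure Decoupled (Θ T N₀ : ℝ) (h : Channel L M) (m : Directions L M) (g : Powers M) : Prop where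
  pos : ∀ ψ k q, 0 < g ψ k q
  rate_eq : ∀ P ψ k, rate Θ T N₀ h m P ψ k =
    csiFactor M Θ T * ∑ q, Real.log (1 + P ψ k q * g ψ k q / N₀)

theorem decoupled_of_isDesign (hu : ∀ ψ k, IsUnit (othersGram h ψ k).det) (hm : IsDesign h m)
    (Θ T N₀ : ℝ) : Decoupled Θ T N₀ h m (fun ψ k q => gain h m ψ k q k q) where
  pos ψ k q := (gain_of_isDesign hu hm ψ k q).2.2.1
  rate_eq P ψ k := by simp only [rate, sinr_of_isDesign hu hm]

theorem minRate_le (Θ T N₀ : ℝ) (h : Channel L M) (m : Directions L M) (P : Powers M) (ψ : Ψ)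
    (k : Fin Q) : minRate Θ T N₀ h m P ≤ rate Θ T N₀ h m P ψ k :=
  ciInf_le (Set.finite_range _).bddBelow (ψ, k)

theorem le_minRate [Nonempty Ψ] (hQ : 0 < Q) {c : ℝ}
    (hc : ∀ ψ k, c ≤ rate Θ T N₀ h m P ψ k) : c ≤ minRate Θ T N₀ h m P := by
  have : Nonempty (Fin Q) := ⟨⟨0, hQ⟩⟩
  exact le_ciInf fun u => hc u.1 u.2

theorem lt_minRate [Nonempty Ψ] (hQ : 0 < Q) {c : ℝ}
    (hc : ∀ ψ k, c < rate Θ T N₀ h m P ψ k) : c < minRate Θ T N₀ h m P := by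
  have : Nonempty (Fin Q) := ⟨⟨0, hQ⟩⟩
  obtain ⟨u, hu⟩ := exists_eq_ciInf_of_finite (f := fun u : Ψ × Fin Q => rate Θ T N₀ h m P u.1 u.2)
  rw [minRate, ← hu]
  exact hc u.1 u.2

theorem isCompact_feasible (M : Ψ → Fin Q → ℕ) (Ptot : ℝ) :
    IsCompact {P : Powers M | Feasible Ptot P} := by
  have h1 : IsCompact {P : Powers M | ∀ ψ, P ψ ∈ {P : ∀ k, Fin (M ψ k) → ℝ |
      ∀ k, P k ∈ {P : Fin (M ψ k) → ℝ | ∀ q, P q ∈ Set.Icc 0 Ptot}}} :=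
    isCompact_pi_infinite fun ψ => isCompact_pi_infinite fun k =>
      isCompact_pi_infinite fun q => isCompact_Icc
  refine h1.of_isClosed_subset ?_ ?_
  · have h2 : Continuous fun P : Powers M => totalPower P := by
      unfold totalPower; fun_prop
    have h3 : IsClosed {P : Powers M | ∀ ψ k q, 0 ≤ P ψ k q} := by
      simp only [Set.ofPred_forall]
      exact isClosed_iInter fun ψ => isClosed_iInter fun k => isClosed_iInter fun q =>
        isClosed_le continuous_const (by fun_prop)
    exact h3.inter (isClosed_le h2 continuous_const)
  · rintro P ⟨h0, hP⟩ ψ k q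
    refine ⟨h0 ψ k q, le_trans ?_ hP⟩
    calc P ψ k q ≤ ∑ q, P ψ k q :=
          Finset.single_le_sum (f := fun q => P ψ k q) (fun q _ => h0 ψ k q) (Finset.mem_univ q)
      _ ≤ ∑ k, ∑ q, P ψ k q := Finset.single_le_sum (f := fun k => ∑ q, P ψ k q)
          (fun k _ => Finset.sum_nonneg fun q _ => h0 ψ k q) (Finset.mem_univ k)
      _ ≤ _ := Finset.single_le_sum (f := fun ψ => ∑ k, ∑ q, P ψ k q)
          (fun ψ _ => Finset.sum_nonneg fun k _ => Finset.sum_nonneg fun q _ => h0 ψ k q)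
          (Finset.mem_univ ψ)

theorem feasible_zero (hPtot : 0 ≤ Ptot) : Feasible Ptot (fun _ _ _ => 0 : Powers M) :=
  ⟨fun _ _ _ => le_rfl, by simpa [totalPower] using hPtot⟩

theorem Decoupled.one_le (hg : Decoupled Θ T N₀ h m g) (hN₀ : 0 < N₀) {ψ : Ψ} {k : Fin Q}
    {q : Fin (M ψ k)} {p : ℝ} (hp : 0 ≤ p) : 1 ≤ 1 + p * g ψ k q / N₀ := by
  have := hg.pos ψ k q
  have : 0 ≤ p * g ψ k q / N₀ := by positivity
  linarith

theorem Decoupled.exists_isMMFOptimal (hg : Decoupled Θ T N₀ h m g) [Nonempty Ψ] (hQ : 0 < Q)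
    (hN₀ : 0 < N₀) (hPtot : 0 ≤ Ptot) :
    ∃ P, IsMMFOptimal Θ T N₀ Ptot h m P := by
  have : Nonempty (Fin Q) := ⟨⟨0, hQ⟩⟩
  have hcont : ContinuousOn (fun P => minRate Θ T N₀ h m P) {P : Powers M | Feasible Ptot P} := by
    have e : (fun P => minRate Θ T N₀ h m P) = fun P => Finset.univ.inf' Finset.univ_nonempty
        fun u : Ψ × Fin Q => rate Θ T N₀ h m P u.1 u.2 := by
      funext P
      rw [Finset.inf'_univ_eq_ciInf]
      rfl
    rw [e]
    refine ContinuousOn.finset_inf'_apply _ fun u _ => ?_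
    simp only [hg.rate_eq]
    refine continuousOn_const.mul (continuousOn_finsetSum _ fun q _ => ContinuousOn.log
      (Continuous.continuousOn (by fun_prop)) fun P hP => ?_)
    have := hg.one_le hN₀ (q := q) (hP.1 u.1 u.2 q)
    exact (zero_lt_one.trans_le this).ne'
  obtain ⟨P, hP, hmax⟩ := (isCompact_feasible M Ptot).exists_isMaxOn ⟨_, feasible_zero hPtot⟩ hcont
  exact ⟨P, hP, fun P' hP' => hmax hP'⟩

/-- At an optimum no user can be served at the minimum rate with less power. -/
theorem Decoupled.sum_le_of_isMMFOptimal (hg : Decoupled Θ T N₀ h m g) [Nonempty Ψ] (hQ : 0 < Q)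
    (hM : ∀ ψ k, 0 < M ψ k) (hN₀ : 0 < N₀) (hξ : 0 < csiFactor M Θ T)
    (hP : IsMMFOptimal Θ T N₀ Ptot h m P) (ψ : Ψ) (k : Fin Q) {p : Fin (M ψ k) → ℝ}
    (hp0 : ∀ q, 0 ≤ p q)
    (hp : minRate Θ T N₀ h m P ≤ csiFactor M Θ T * ∑ q, Real.log (1 + p q * g ψ k q / N₀)) :
    ∑ q, P ψ k q ≤ ∑ q, p q := by
  classical
  by_contra! hlt
  have hQ' : Nonempty (Fin Q) := ⟨⟨0, hQ⟩⟩
  set s := ∑ q, P ψ k q - ∑ q, p q with hs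
  have hspos : 0 < s := sub_pos.2 hlt
  set n : ℝ := ∑ ψ, ∑ k, (M ψ k : ℝ) with hn
  have hnpos : 0 < n := Finset.sum_pos (fun ψ _ => Finset.sum_pos
    (fun k _ => by exact_mod_cast hM ψ k) Finset.univ_nonempty) Finset.univ_nonempty
  set P₁ : Powers M := Function.update P ψ (Function.update (P ψ) k p) with hP₁
  have hsame : P₁ ψ k = p := by simp [hP₁]
  have hother : ∀ ψ' k', ¬ (ψ' = ψ ∧ k' = k) → P₁ ψ' k' = P ψ' k' := by
    intro ψ' k' hne
    by_cases h1 : ψ' = ψ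
    · subst h1
      have h2 : k' ≠ k := fun h2 => hne ⟨rfl, h2⟩
      simp [hP₁, h2]
    · simp [hP₁, h1]
  have hP₁0 : ∀ ψ' k' q, 0 ≤ P₁ ψ' k' q := by
    intro ψ' k'
    by_cases h1 : ψ' = ψ ∧ k' = k
    · obtain ⟨rfl, rfl⟩ := h1
      rw [hsame]; exact hp0
    · rw [hother _ _ h1]; exact hP.1.1 ψ' k'
  have hP₁rate : ∀ ψ' k', minRate Θ T N₀ h m P ≤ rate Θ T N₀ h m P₁ ψ' k' := by
    intro ψ' k'
    by_cases h1 : ψ' = ψ ∧ k' = k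
    · obtain ⟨rfl, rfl⟩ := h1
      rw [hg.rate_eq, hsame]; exact hp
    · rw [hg.rate_eq, hother _ _ h1, ← hg.rate_eq]; exact minRate_le _ _ _ _ _ _ _ _
  have hP₁tot : totalPower P₁ = totalPower P - s := by
    have h1 : ∀ ψ' k', ∑ q, P₁ ψ' k' q =
        ∑ q, P ψ' k' q - if ψ' = ψ then (if k' = k then s else 0) else 0 := by
      intro ψ' k'
      by_cases h1 : ψ' = ψ ∧ k' = k
      · obtain ⟨rfl, rfl⟩ := h1
        rw [hsame]; simp [hs]
      · rw [hother _ _ h1, ← ite_and, if_neg h1, sub_zero]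
    simp only [totalPower, h1, Finset.sum_sub_distrib]
    simp
  -- The saved power `s` is shared equally by all `n` streams. This restores the original total and
  -- strictly raises every user's rate above the old minimum, contradicting optimality.
  set P₂ : Powers M := fun ψ k q => P₁ ψ k q + s / n with hP₂
  have hfeas : Feasible Ptot P₂ := by
    refine ⟨fun ψ k q => add_nonneg (hP₁0 ψ k q) (by positivity), ?_⟩
    have h1 : totalPower P₂ = totalPower P₁ + n * (s / n) := by
      simp only [totalPower, hP₂, Finset.sum_add_distrib, hn, Finset.sum_mul]
      simp
    rw [h1, hP₁tot, mul_div_cancel₀ _ hnpos.ne']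
    linarith [hP.1.2]
  refine (hP.2 P₂ hfeas).not_gt (lt_minRate hQ fun ψ' k' => (hP₁rate ψ' k').trans_lt ?_)
  rw [hg.rate_eq, hg.rate_eq]
  have : Nonempty (Fin (M ψ' k')) := ⟨⟨0, hM ψ' k'⟩⟩
  refine mul_lt_mul_of_pos_left (Finset.sum_lt_sum_of_nonempty Finset.univ_nonempty fun q _ => ?_) hξ
  refine Real.log_lt_log (zero_lt_one.trans_le (hg.one_le hN₀ (hP₁0 ψ' k' q))) ?_
  have h1 := hg.pos ψ' k' q
  have h2 : P₁ ψ' k' q < P₂ ψ' k' q := by simp only [hP₂]; linarith [div_pos hspos hnpos]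
  gcongr

/-- Stability in the inequality of arithmetic and geometric means. -/
theorem sub_one_sub_log_le {n : Type*} [Fintype n] {x : n → ℝ} (hx : ∀ q, 0 < x q) {X : ℝ}
    (hX : 0 < X) (h : Fintype.card n * Real.log X ≤ ∑ q, Real.log (x q)) (q : n) :
    x q / X - 1 - Real.log (x q / X) ≤ (∑ q, x q) / X - Fintype.card n := by
  have h1 : ∀ q, 0 ≤ x q / X - 1 - Real.log (x q / X) := fun q => by
    have := Real.log_le_sub_one_of_pos (div_pos (hx q) hX)
    linarith
  -- All the defects `y - 1 - log y` are nonnegative, so one of them is at most their sum, in which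
  -- the logarithms contribute at most `0` by hypothesis.
  refine (Finset.single_le_sum (f := fun q => x q / X - 1 - Real.log (x q / X))
    (fun q _ => h1 q) (Finset.mem_univ q)).trans ?_
  simp only [Finset.sum_sub_distrib, Finset.sum_div]
  have h2 : ∑ q, Real.log (x q / X) = ∑ q, Real.log (x q) - Fintype.card n * Real.log X := by
    rw [Finset.sum_congr rfl fun q _ => Real.log_div (hx q).ne' hX.ne', Finset.sum_sub_distrib]
    simp
  rw [h2]
  simp only [Finset.sum_const, Finset.card_univ, nsmul_eq_mul, mul_one]
  linarith

theorem card_mul_le_sum {n : Type*} [Fintype n] {x : n → ℝ} (hx : ∀ q, 0 < x q) {X : ℝ}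
    (hX : 0 < X) (h : Fintype.card n * Real.log X ≤ ∑ q, Real.log (x q)) :
    Fintype.card n * X ≤ ∑ q, x q := by
  rcases isEmpty_or_nonempty n with hn | ⟨⟨q⟩⟩
  · simp
  · have h1 := sub_one_sub_log_le hx hX h q
    have h2 := Real.log_le_sub_one_of_pos (div_pos (hx q) hX)
    have h3 : (Fintype.card n : ℝ) ≤ (∑ q, x q) / X := by linarith
    rwa [le_div_iff₀ hX] at h3

theorem card_le_totalAntennas (M : Ψ → Fin Q → ℕ) (ψ : Ψ) (k : Fin Q) :
    (M ψ k : ℝ) ≤ ∑ ψ, ∑ k, (M ψ k : ℝ) :=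
  (Finset.single_le_sum (f := fun k => (M ψ k : ℝ)) (fun _ _ => Nat.cast_nonneg _)
    (Finset.mem_univ k)).trans (Finset.single_le_sum (f := fun ψ => ∑ k, (M ψ k : ℝ))
    (fun _ _ => Finset.sum_nonneg fun _ _ => Nat.cast_nonneg _) (Finset.mem_univ ψ))

/-- If the gains were exactly `detEig`, every factor `1 + SINR` would be `exp r`. Changing a gain by
a factor between `κ⁻¹` and `κ` changes `1 + SINR` by at most a factor `κ`, which costs `log κ` per
stream. -/
theorem Decoupled.abs_rate_detPower_sub_le (hg : Decoupled Θ T N₀ h m g) [Nonempty Ψ] (hQ : 0 < Q)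
    (hM : ∀ ψ k, 0 < M ψ k) (hN₀ : 0 < N₀) (hξ : 0 < csiFactor M Θ T)
    (hD : ∀ ψ k, 0 < detEig M β L ψ k) {κ : ℝ} (hκ : GainsClose κ β L g) {R : ℝ} (hR : 0 ≤ R)
    (ψ : Ψ) (k : Fin Q) :
    |rate Θ T N₀ h m (detPower Θ T N₀ M β L R) ψ k - R / numUsers Ψ Q| ≤
      csiFactor M Θ T * (∑ ψ, ∑ k, (M ψ k : ℝ)) * Real.log κ := by
  have hM' : (0 : ℝ) < M ψ k := by exact_mod_cast hM ψ k
  have hN := numUsers_pos Ψ hQ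
  have hκ0 : 0 < κ := zero_lt_one.trans_le hκ.one_le
  set r := R / (csiFactor M Θ T * (M ψ k : ℝ) * numUsers Ψ Q) with hr
  have hr0 : 0 ≤ r := by positivity
  have hE : 1 ≤ Real.exp r := Real.one_le_exp hr0
  have h1 : R / numUsers Ψ Q = csiFactor M Θ T * ∑ q : Fin (M ψ k), r := by
    simp only [Finset.sum_const, Finset.card_univ, Fintype.card_fin, nsmul_eq_mul, hr]
    field_simp
  rw [hg.rate_eq, h1, ← mul_sub, ← Finset.sum_sub_distrib, abs_mul, abs_of_pos hξ, mul_assoc]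
  refine mul_le_mul_of_nonneg_left ?_ hξ.le
  refine (Finset.abs_sum_le_sum_abs _ _).trans ?_
  have h2 : ∀ q : Fin (M ψ k),
      |Real.log (1 + detPower Θ T N₀ M β L R ψ k q * g ψ k q / N₀) - r| ≤ Real.log κ := by
    intro q
    have hgp := hg.pos ψ k q
    have hDp := hD ψ k
    set ρ := g ψ k q / detEig M β L ψ k with hρ
    have hρ1 : ρ ≤ κ := (div_le_iff₀ hDp).2 (hκ.upper ψ k q)
    have hρ2 : 1 ≤ κ * ρ := by
      rw [hρ, ← mul_div_assoc, le_div_iff₀ hDp, one_mul]; exact hκ.lower ψ k q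
    have h3 : 1 + detPower Θ T N₀ M β L R ψ k q * g ψ k q / N₀ = 1 + (Real.exp r - 1) * ρ := by
      rw [detPower, ← hr, hρ]; field_simp
    have hρpos : 0 < ρ := div_pos hgp hDp
    have h4 : 0 < 1 + (Real.exp r - 1) * ρ := by
      have : 0 ≤ (Real.exp r - 1) * ρ := mul_nonneg (by linarith) hρpos.le
      linarith
    rw [h3, abs_le]
    constructor
    · have : Real.exp r ≤ κ * (1 + (Real.exp r - 1) * ρ) := by nlinarith [hκ.one_le]
      have := Real.log_le_log (Real.exp_pos r) this
      rw [Real.log_exp, Real.log_mul hκ0.ne' h4.ne'] at this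
      linarith
    · have : 1 + (Real.exp r - 1) * ρ ≤ κ * Real.exp r := by nlinarith [hκ.one_le]
      have := Real.log_le_log h4 this
      rw [Real.log_mul hκ0.ne' (Real.exp_pos r).ne', Real.log_exp] at this
      linarith
  refine (Finset.sum_le_sum fun q _ => h2 q).trans ?_
  simp only [Finset.sum_const, Finset.card_univ, Fintype.card_fin, nsmul_eq_mul]
  exact mul_le_mul_of_nonneg_right (card_le_totalAntennas M ψ k) (Real.log_nonneg hκ.one_le)

/-- The rate fixes a lower bound for the geometric mean of the factors `1 + SINR`. Their arithmetic
mean is at least as large, and it is controlled by the user's total power alone. -/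
theorem Decoupled.power_ge_of_le_rate (hg : Decoupled Θ T N₀ h m g)
    (hM : ∀ ψ k, 0 < M ψ k) (hN₀ : 0 < N₀) (hξ : 0 < csiFactor M Θ T)
    {κ : ℝ} (hκ : GainsClose κ β L g) (hP : ∀ ψ k q, 0 ≤ P ψ k q) {ψ : Ψ} {k : Fin Q} {c : ℝ}
    (hc : c ≤ rate Θ T N₀ h m P ψ k) :
    N₀ * M ψ k * (Real.exp (c / (csiFactor M Θ T * M ψ k)) - 1) ≤
      κ * detEig M β L ψ k * ∑ q, P ψ k q := by
  have hM' : (0 : ℝ) < M ψ k := by exact_mod_cast hM ψ k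
  have hx : ∀ q, 0 < 1 + P ψ k q * g ψ k q / N₀ := fun q =>
    zero_lt_one.trans_le (hg.one_le hN₀ (hP ψ k q))
  have h1 : Fintype.card (Fin (M ψ k)) * Real.log (Real.exp (c / (csiFactor M Θ T * M ψ k))) ≤
      ∑ q, Real.log (1 + P ψ k q * g ψ k q / N₀) := by
    rw [Real.log_exp, Fintype.card_fin]
    rw [hg.rate_eq] at hc
    calc (M ψ k : ℝ) * (c / (csiFactor M Θ T * M ψ k)) = c / csiFactor M Θ T := by field_simp
      _ ≤ _ := by rwa [div_le_iff₀ hξ, mul_comm]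
  have h2 := card_mul_le_sum hx (Real.exp_pos _) h1
  have h3 := hκ.sum_one_add_le hN₀ hP ψ k
  rw [Fintype.card_fin] at h2
  have h4 := h2.trans h3
  rw [← sub_le_iff_le_add', le_div_iff₀ hN₀] at h4
  linarith

/-- Otherwise every user would need strictly more power than in the explicit allocation, which
already uses the whole budget. The `log κ` in the rate is what absorbs the factor `κ` in the power
bound. -/
theorem Decoupled.le_of_feasible (hg : Decoupled Θ T N₀ h m g) [Nonempty Ψ] (hQ : 0 < Q)
    (hM : ∀ ψ k, 0 < M ψ k) (hN₀ : 0 < N₀) (hξ : 0 < csiFactor M Θ T)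
    (hD : ∀ ψ k, 0 < detEig M β L ψ k) {κ : ℝ} (hκ : GainsClose κ β L g) {R : ℝ}
    (hR : SolvesExpEq Θ T N₀ Ptot M β L R) (hP : Feasible Ptot P) {c : ℝ}
    (hc : ∀ ψ k, c ≤ rate Θ T N₀ h m P ψ k) :
    c ≤ R / numUsers Ψ Q + csiFactor M Θ T * (∑ ψ, ∑ k, (M ψ k : ℝ)) * Real.log κ := by
  by_contra! hlt
  have hQ' : Nonempty (Fin Q) := ⟨⟨0, hQ⟩⟩
  have hN := numUsers_pos Ψ hQ
  have hκ0 : 0 < κ := zero_lt_one.trans_le hκ.one_le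
  have h1 : ∀ ψ k, N₀ * (M ψ k : ℝ) *
      (Real.exp (R / (csiFactor M Θ T * (M ψ k : ℝ) * numUsers Ψ Q)) - 1) / detEig M β L ψ k <
      ∑ q, P ψ k q := by
    intro ψ k
    have hM' : (0 : ℝ) < M ψ k := by exact_mod_cast hM ψ k
    have h2 := hg.power_ge_of_le_rate hM hN₀ hξ hκ hP.1 (hc ψ k)
    rw [div_lt_iff₀ (hD ψ k)]
    set r := R / (csiFactor M Θ T * (M ψ k : ℝ) * numUsers Ψ Q) with hr
    have h3 : r + Real.log κ < c / (csiFactor M Θ T * M ψ k) := by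
      rw [lt_div_iff₀ (by positivity)]
      refine lt_of_le_of_lt ?_ hlt
      rw [add_mul]
      refine add_le_add (le_of_eq ?_) ?_
      · rw [hr]; field_simp
      · have := mul_le_mul_of_nonneg_right (mul_le_mul_of_nonneg_left
          (card_le_totalAntennas M ψ k) hξ.le) (Real.log_nonneg hκ.one_le)
        linarith
    have h4 := Real.exp_lt_exp.2 h3
    rw [Real.exp_add, Real.exp_log hκ0] at h4
    have h5 : κ * (Real.exp r - 1) < Real.exp (c / (csiFactor M Θ T * M ψ k)) - 1 := by
      linarith [hκ.one_le]
    have h6 : κ * (N₀ * M ψ k * (Real.exp r - 1)) < κ * (∑ q, P ψ k q) * detEig M β L ψ k := by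
      have := mul_lt_mul_of_pos_left h5 (mul_pos hN₀ hM')
      linarith
    rw [mul_assoc κ] at h6
    exact lt_of_mul_lt_mul_left h6 hκ0.le
  have h7 := Finset.sum_lt_sum_of_nonempty (s := (Finset.univ : Finset Ψ)) Finset.univ_nonempty
    fun ψ _ => Finset.sum_lt_sum_of_nonempty (s := (Finset.univ : Finset (Fin Q)))
      Finset.univ_nonempty fun k _ => h1 ψ k
  rw [hR] at h7
  exact h7.not_ge hP.2

/-- At an optimum the factors `1 + SINR` of a user nearly agree. -/
theorem Decoupled.sub_one_sub_log_le_of_isMMFOptimal (hg : Decoupled Θ T N₀ h m g) [Nonempty Ψ]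
    (hQ : 0 < Q) (hM : ∀ ψ k, 0 < M ψ k) (hN₀ : 0 < N₀) (hξ : 0 < csiFactor M Θ T)
    (hD : ∀ ψ k, 0 < detEig M β L ψ k) {κ : ℝ} (hκ : GainsClose κ β L g)
    (hP : IsMMFOptimal Θ T N₀ Ptot h m P) (ψ : Ψ) (k : Fin Q) (q : Fin (M ψ k)) {X : ℝ}
    (hX : X = Real.exp (minRate Θ T N₀ h m P / (csiFactor M Θ T * M ψ k))) :
    (1 + P ψ k q * g ψ k q / N₀) / X - 1 - Real.log ((1 + P ψ k q * g ψ k q / N₀) / X) ≤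
      M ψ k * (κ ^ 2 - 1) := by
  have hM' : (0 : ℝ) < M ψ k := by exact_mod_cast hM ψ k
  have hκ0 : 0 < κ := zero_lt_one.trans_le hκ.one_le
  have hDp := hD ψ k
  have ht : 0 ≤ minRate Θ T N₀ h m P := le_minRate hQ fun ψ k => by
    rw [hg.rate_eq]
    exact mul_nonneg hξ.le (Finset.sum_nonneg fun q _ =>
      Real.log_nonneg (hg.one_le hN₀ (hP.1.1 ψ k q)))
  have hX1 : 1 ≤ X := hX ▸ Real.one_le_exp (by positivity)
  have hX0 : 0 < X := zero_lt_one.trans_le hX1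
  have hlogX : Real.log X = minRate Θ T N₀ h m P / (csiFactor M Θ T * M ψ k) := by
    rw [hX, Real.log_exp]
  -- The competitor spreads power equally over the user's streams, enlarged by `κ` so that even the
  -- weakest gain gives `1 + SINR ≥ X`, hence the minimum rate.
  have hsum := hg.sum_le_of_isMMFOptimal hQ hM hN₀ hξ hP ψ k
    (p := fun _ => N₀ * κ * (X - 1) / detEig M β L ψ k)
    (fun _ => div_nonneg (mul_nonneg (by positivity) (by linarith)) hDp.le) (by
      have h1 : ∀ q : Fin (M ψ k), Real.log X ≤
          Real.log (1 + N₀ * κ * (X - 1) / detEig M β L ψ k * g ψ k q / N₀) := fun q => by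
        refine Real.log_le_log hX0 ?_
        have h2 : 1 ≤ κ * g ψ k q / detEig M β L ψ k := by
          rw [le_div_iff₀ hDp, one_mul]; exact hκ.lower ψ k q
        have h3 : N₀ * κ * (X - 1) / detEig M β L ψ k * g ψ k q / N₀ =
            (X - 1) * (κ * g ψ k q / detEig M β L ψ k) := by field_simp
        rw [h3]
        nlinarith
      calc minRate Θ T N₀ h m P = csiFactor M Θ T * ∑ q : Fin (M ψ k), Real.log X := by
            rw [hlogX]
            simp only [Finset.sum_const, Finset.card_univ, Fintype.card_fin, nsmul_eq_mul]
            field_simp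
        _ ≤ _ := mul_le_mul_of_nonneg_left (Finset.sum_le_sum fun q _ => h1 q) hξ.le)
  simp only [Finset.sum_const, Finset.card_univ, Fintype.card_fin, nsmul_eq_mul] at hsum
  have hx : ∀ q, 0 < 1 + P ψ k q * g ψ k q / N₀ := fun q =>
    zero_lt_one.trans_le (hg.one_le hN₀ (hP.1.1 ψ k q))
  have h1 : Fintype.card (Fin (M ψ k)) * Real.log X ≤
      ∑ q, Real.log (1 + P ψ k q * g ψ k q / N₀) := by
    have hc := minRate_le Θ T N₀ h m P ψ k
    rw [hg.rate_eq] at hc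
    rw [hlogX, Fintype.card_fin]
    calc (M ψ k : ℝ) * (minRate Θ T N₀ h m P / (csiFactor M Θ T * M ψ k)) =
          minRate Θ T N₀ h m P / csiFactor M Θ T := by field_simp
      _ ≤ _ := by rwa [div_le_iff₀ hξ, mul_comm]
  refine (sub_one_sub_log_le hx hX0 h1 q).trans ?_
  have h3 := hκ.sum_one_add_le hN₀ hP.1.1 ψ k
  have h4 : κ * detEig M β L ψ k * (∑ q, P ψ k q) / N₀ ≤ κ ^ 2 * M ψ k * (X - 1) := by
    rw [div_le_iff₀ hN₀]
    calc κ * detEig M β L ψ k * (∑ q, P ψ k q) ≤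
          κ * detEig M β L ψ k * (M ψ k * (N₀ * κ * (X - 1) / detEig M β L ψ k)) := by gcongr
      _ = _ := by field_simp
  -- One factor `κ` comes from the competitor, one from the upper bound on the gains; the sum is at
  -- most `M + κ² M (X - 1) ≤ κ² M X`.
  have h5 : (∑ q, (1 + P ψ k q * g ψ k q / N₀)) / X ≤ κ ^ 2 * M ψ k := by
    rw [div_le_iff₀ hX0]
    have : 1 ≤ κ ^ 2 := one_le_pow₀ hκ.one_le
    nlinarith
  rw [Fintype.card_fin]
  linarith

end Optimization

/-! ### Asymptotics of optimal rates and powers -/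

/-- From `log √y ≤ √y - 1` one gets `(√y - 1)² ≤ y - 1 - log y`. -/
theorem tendsto_one_of_sub_one_sub_log_le {X : Type*} {f : Filter X} {y δ : X → ℝ}
    (hy : ∀ᶠ x in f, 0 < y x) (h : ∀ᶠ x in f, y x - 1 - Real.log (y x) ≤ δ x)
    (hδ : Tendsto δ f (𝓝 0)) : Tendsto y f (𝓝 1) := by
  have h1 : Tendsto (fun x => (√(y x) - 1) ^ 2) f (𝓝 0) := by
    refine squeeze_zero' (Eventually.of_forall fun x => sq_nonneg _) ?_ hδ
    filter_upwards [hy, h] with x hx hx'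
    refine le_trans ?_ hx'
    have h2 := Real.log_le_sub_one_of_pos (Real.sqrt_pos.2 hx)
    rw [Real.log_sqrt hx.le] at h2
    have h3 := Real.sq_sqrt hx.le
    nlinarith
  have h2 := h1.sqrt
  simp only [Real.sqrt_sq_eq_abs, Real.sqrt_zero] at h2
  have h3 : Tendsto (fun x => √(y x)) f (𝓝 1) := by
    simpa using ((tendsto_zero_iff_abs_tendsto_zero _).2 h2).add_const 1
  have h4 := h3.pow 2
  rw [one_pow] at h4
  refine h4.congr' ?_
  filter_upwards [hy] with x hx
  exact Real.sq_sqrt hx.le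

section Asymptotics

variable {Ψ : Type*} [Fintype Ψ] {Q : ℕ} {M : Ψ → Fin Q → ℕ} {β : Ψ → Fin Q → ℝ}
  {N₀ Ptot Θ T : ℝ} {h : ∀ L : ℕ, Channel L M} {m : ∀ L : ℕ, Directions L M}
  {g P : ℕ → Powers M} {κ R : ℕ → ℝ}

/-- There are finitely many streams, so `1` plus the sum of the deviations from `1` of all gain
ratios and of their inverses serves as a common `κ`. -/
theorem exists_gainsClose (hβ : ∀ ψ k, 0 < β ψ k)
    (hpos : ∀ᶠ L in atTop, ∀ ψ k q, 0 < g L ψ k q)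
    (hg : ∀ ψ k q, Tendsto (fun L => g L ψ k q / detEig M β L ψ k) atTop (𝓝 1)) :
    ∃ κ : ℕ → ℝ, Tendsto κ atTop (𝓝 1) ∧ ∀ᶠ L in atTop, GainsClose (κ L) β L (g L) := by
  set d : ℕ → ∀ ψ k, Fin (M ψ k) → ℝ := fun L ψ k q =>
    |g L ψ k q / detEig M β L ψ k - 1| + |(g L ψ k q / detEig M β L ψ k)⁻¹ - 1| with hd
  have hd0 : ∀ L ψ k q, 0 ≤ d L ψ k q := fun L ψ k q => by positivity
  refine ⟨fun L => 1 + ∑ ψ, ∑ k, ∑ q, d L ψ k q, ?_, ?_⟩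
  · have h1 : Tendsto (fun L => ∑ ψ, ∑ k, ∑ q, d L ψ k q) atTop
        (𝓝 (∑ ψ : Ψ, ∑ k : Fin Q, ∑ _ : Fin (M ψ k), (|(1 : ℝ) - 1| + |(1 : ℝ)⁻¹ - 1|))) :=
      tendsto_finsetSum _ fun ψ _ => tendsto_finsetSum _ fun k _ => tendsto_finsetSum _ fun q _ =>
        ((hg ψ k q).sub_const 1).abs.add (((hg ψ k q).inv₀ one_ne_zero).sub_const 1).abs
    simpa using h1.const_add 1
  · filter_upwards [hpos, eventually_detEig_pos (M := M) hβ] with L hp hD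
    have hle : ∀ ψ k q, d L ψ k q ≤ ∑ ψ, ∑ k, ∑ q, d L ψ k q := fun ψ k q =>
      calc d L ψ k q ≤ ∑ q, d L ψ k q :=
            Finset.single_le_sum (f := fun q => d L ψ k q) (fun q _ => hd0 L ψ k q)
              (Finset.mem_univ q)
        _ ≤ ∑ k, ∑ q, d L ψ k q := Finset.single_le_sum (f := fun k => ∑ q, d L ψ k q)
            (fun k _ => Finset.sum_nonneg fun q _ => hd0 L ψ k q) (Finset.mem_univ k)
        _ ≤ _ := Finset.single_le_sum (f := fun ψ => ∑ k, ∑ q, d L ψ k q)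
            (fun ψ _ => Finset.sum_nonneg fun k _ => Finset.sum_nonneg fun q _ => hd0 L ψ k q)
            (Finset.mem_univ ψ)
    refine ⟨?_, fun ψ k q => ?_, fun ψ k q => ?_⟩
    · have : 0 ≤ ∑ ψ, ∑ k, ∑ q, d L ψ k q := Finset.sum_nonneg fun ψ _ =>
        Finset.sum_nonneg fun k _ => Finset.sum_nonneg fun q _ => hd0 L ψ k q
      linarith
    · rw [← div_le_iff₀ (hD ψ k)]
      have h1 := hle ψ k q
      have h2 := le_abs_self (g L ψ k q / detEig M β L ψ k - 1)
      have h3 := abs_nonneg ((g L ψ k q / detEig M β L ψ k)⁻¹ - 1)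
      simp only [hd] at h1 ⊢
      linarith
    · rw [← div_le_iff₀ (hp ψ k q), ← inv_div]
      have h1 := hle ψ k q
      have h2 := le_abs_self ((g L ψ k q / detEig M β L ψ k)⁻¹ - 1)
      have h3 := abs_nonneg (g L ψ k q / detEig M β L ψ k - 1)
      simp only [hd] at h1 ⊢
      linarith

/-- The channels decouple eventually, with gains asymptotic to the deterministic ones. -/
structure HasAsymptoticGains (Θ T N₀ : ℝ) (β : Ψ → Fin Q → ℝ) (h : ∀ L : ℕ, Channel L M)
    (m : ∀ L : ℕ, Directions L M) (g : ℕ → Powers M) (κ : ℕ → ℝ) : Prop where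
  decoupled : ∀ᶠ L in atTop, Decoupled Θ T N₀ (h L) (m L) (g L)
  close : ∀ᶠ L in atTop, GainsClose (κ L) β L (g L)
  tendsto_one : Tendsto κ atTop (𝓝 1)

theorem HasAsymptoticGains.tendsto_error (hg : HasAsymptoticGains Θ T N₀ β h m g κ) :
    Tendsto (fun L => csiFactor M Θ T * (∑ ψ, ∑ k, (M ψ k : ℝ)) * Real.log (κ L))
      atTop (𝓝 0) := by
  have := (hg.tendsto_one.log one_ne_zero).const_mul (csiFactor M Θ T * (∑ ψ, ∑ k, (M ψ k : ℝ)))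
  simpa using this

theorem eventually_solution_pos [Nonempty Ψ] (hQ : 0 < Q) (hM : ∀ ψ k, 0 < M ψ k)
    (hβ : ∀ ψ k, 0 < β ψ k) (hN₀ : 0 < N₀) (hPtot : 0 < Ptot) (hξ : 0 < csiFactor M Θ T)
    (hR : ∀ᶠ L : ℕ in atTop, SolvesExpEq Θ T N₀ Ptot M β L (R L)) : ∀ᶠ L in atTop, 0 < R L :=
  (tendsto_solution_atTop hQ hM hβ hN₀ hPtot hξ hR).eventually_gt_atTop 0

theorem eventually_feasible_detPower [Nonempty Ψ] (hQ : 0 < Q) (hM : ∀ ψ k, 0 < M ψ k)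
    (hβ : ∀ ψ k, 0 < β ψ k) (hN₀ : 0 < N₀) (hPtot : 0 < Ptot) (hξ : 0 < csiFactor M Θ T)
    (hR : ∀ᶠ L : ℕ in atTop, SolvesExpEq Θ T N₀ Ptot M β L (R L)) :
    ∀ᶠ L : ℕ in atTop, Feasible Ptot (detPower Θ T N₀ M β L (R L)) ∧
      totalPower (detPower Θ T N₀ M β L (R L)) = Ptot := by
  filter_upwards [hR, eventually_solution_pos hQ hM hβ hN₀ hPtot hξ hR,
    eventually_detEig_pos (M := M) hβ] with L hL hpos hD
  have h1 := totalPower_detPower hL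
  exact ⟨⟨fun ψ k q => (detPower_pos hM hQ hN₀ hξ hD hpos ψ k q).le, h1.le⟩, h1⟩

variable [Nonempty Ψ]

theorem HasAsymptoticGains.tendsto_rate_detPower (hg : HasAsymptoticGains Θ T N₀ β h m g κ)
    (hQ : 0 < Q) (hM : ∀ ψ k, 0 < M ψ k)
    (hβ : ∀ ψ k, 0 < β ψ k) (hN₀ : 0 < N₀) (hPtot : 0 < Ptot) (hξ : 0 < csiFactor M Θ T)
    (hR : ∀ᶠ L : ℕ in atTop, SolvesExpEq Θ T N₀ Ptot M β L (R L)) (ψ : Ψ) (k : Fin Q) :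
    Tendsto (fun L : ℕ => rate Θ T N₀ (h L) (m L) (detPower Θ T N₀ M β L (R L)) ψ k
      - R L / numUsers Ψ Q) atTop (𝓝 0) := by
  refine squeeze_zero_norm' ?_ hg.tendsto_error
  filter_upwards [hg.decoupled, hg.close, eventually_detEig_pos (M := M) hβ,
    eventually_solution_pos hQ hM hβ hN₀ hPtot hξ hR] with L hdec hκ hD hpos
  exact hdec.abs_rate_detPower_sub_le hQ hM hN₀ hξ hD hκ hpos.le ψ k

theorem HasAsymptoticGains.eventually_minRate_bounds (hg : HasAsymptoticGains Θ T N₀ β h m g κ)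
    (hQ : 0 < Q) (hM : ∀ ψ k, 0 < M ψ k)
    (hβ : ∀ ψ k, 0 < β ψ k) (hN₀ : 0 < N₀) (hPtot : 0 < Ptot) (hξ : 0 < csiFactor M Θ T)
    (hR : ∀ᶠ L : ℕ in atTop, SolvesExpEq Θ T N₀ Ptot M β L (R L))
    (hP : ∀ᶠ L : ℕ in atTop, IsMMFOptimal Θ T N₀ Ptot (h L) (m L) (P L)) :
    ∀ᶠ L : ℕ in atTop,
      R L / numUsers Ψ Q - csiFactor M Θ T * (∑ ψ, ∑ k, (M ψ k : ℝ)) * Real.log (κ L) ≤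
        minRate Θ T N₀ (h L) (m L) (detPower Θ T N₀ M β L (R L)) ∧
      minRate Θ T N₀ (h L) (m L) (detPower Θ T N₀ M β L (R L)) ≤
        minRate Θ T N₀ (h L) (m L) (P L) ∧
      minRate Θ T N₀ (h L) (m L) (P L) ≤
        R L / numUsers Ψ Q + csiFactor M Θ T * (∑ ψ, ∑ k, (M ψ k : ℝ)) * Real.log (κ L) := by
  filter_upwards [hg.decoupled, hg.close, eventually_detEig_pos (M := M) hβ,
    eventually_solution_pos hQ hM hβ hN₀ hPtot hξ hR, hR, hP,
    eventually_feasible_detPower hQ hM hβ hN₀ hPtot hξ hR] with L hdec hκ hD hpos hL hopt hfeas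
  refine ⟨le_minRate hQ fun ψ k => ?_, hopt.2 _ hfeas.1,
    hdec.le_of_feasible hQ hM hN₀ hξ hD hκ hL hopt.1 fun ψ k => minRate_le _ _ _ _ _ _ _ _⟩
  have := (abs_le.1 (hdec.abs_rate_detPower_sub_le hQ hM hN₀ hξ hD hκ hpos.le ψ k)).1
  linarith

theorem HasAsymptoticGains.tendsto_minRate (hg : HasAsymptoticGains Θ T N₀ β h m g κ)
    (hQ : 0 < Q) (hM : ∀ ψ k, 0 < M ψ k)
    (hβ : ∀ ψ k, 0 < β ψ k) (hN₀ : 0 < N₀) (hPtot : 0 < Ptot) (hξ : 0 < csiFactor M Θ T)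
    (hR : ∀ᶠ L : ℕ in atTop, SolvesExpEq Θ T N₀ Ptot M β L (R L))
    (hP : ∀ᶠ L : ℕ in atTop, IsMMFOptimal Θ T N₀ Ptot (h L) (m L) (P L)) :
    Tendsto (fun L => minRate Θ T N₀ (h L) (m L) (P L) - R L / numUsers Ψ Q) atTop (𝓝 0) ∧
    Tendsto (fun L => minRate Θ T N₀ (h L) (m L) (P L) -
      minRate Θ T N₀ (h L) (m L) (detPower Θ T N₀ M β L (R L))) atTop (𝓝 0) := by
  have hb := hg.eventually_minRate_bounds hQ hM hβ hN₀ hPtot hξ hR hP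
  constructor
  · refine squeeze_zero_norm' ?_ hg.tendsto_error
    filter_upwards [hb] with L ⟨h1, h2, h3⟩
    rw [Real.norm_eq_abs, abs_le]
    constructor <;> linarith
  · have h0 := hg.tendsto_error.add hg.tendsto_error
    rw [add_zero] at h0
    refine squeeze_zero' ?_ ?_ h0
    · filter_upwards [hb] with L ⟨h1, h2, h3⟩
      linarith
    · filter_upwards [hb] with L ⟨h1, h2, h3⟩
      linarith

theorem HasAsymptoticGains.tendsto_sinr_ratio (hg : HasAsymptoticGains Θ T N₀ β h m g κ)
    (hQ : 0 < Q) (hM : ∀ ψ k, 0 < M ψ k)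
    (hβ : ∀ ψ k, 0 < β ψ k) (hN₀ : 0 < N₀) (hξ : 0 < csiFactor M Θ T)
    (hP : ∀ᶠ L : ℕ in atTop, IsMMFOptimal Θ T N₀ Ptot (h L) (m L) (P L))
    (ψ : Ψ) (k : Fin Q) (q : Fin (M ψ k)) :
    Tendsto (fun L => (1 + P L ψ k q * g L ψ k q / N₀) /
      Real.exp (minRate Θ T N₀ (h L) (m L) (P L) / (csiFactor M Θ T * M ψ k))) atTop (𝓝 1) := by
  refine tendsto_one_of_sub_one_sub_log_le (δ := fun L => M ψ k * (κ L ^ 2 - 1)) ?_ ?_ ?_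
  · filter_upwards [hg.decoupled, hP] with L hdec hopt
    exact div_pos (zero_lt_one.trans_le (hdec.one_le hN₀ (hopt.1.1 ψ k q))) (Real.exp_pos _)
  · filter_upwards [hg.decoupled, hg.close, eventually_detEig_pos (M := M) hβ, hP] with
      L hdec hκ hD hopt
    exact hdec.sub_one_sub_log_le_of_isMMFOptimal hQ hM hN₀ hξ hD hκ hopt ψ k q rfl
  · simpa using ((hg.tendsto_one.pow 2).sub_const 1).const_mul (M ψ k : ℝ)

/-- A user's rate exceeds the minimum rate by `ξ` times the sum of the logarithms of the ratios in
`tendsto_sinr_ratio`, and these tend to `0`. -/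
theorem HasAsymptoticGains.tendsto_rate (hg : HasAsymptoticGains Θ T N₀ β h m g κ)
    (hQ : 0 < Q) (hM : ∀ ψ k, 0 < M ψ k)
    (hβ : ∀ ψ k, 0 < β ψ k) (hN₀ : 0 < N₀) (hPtot : 0 < Ptot) (hξ : 0 < csiFactor M Θ T)
    (hR : ∀ᶠ L : ℕ in atTop, SolvesExpEq Θ T N₀ Ptot M β L (R L))
    (hP : ∀ᶠ L : ℕ in atTop, IsMMFOptimal Θ T N₀ Ptot (h L) (m L) (P L)) (ψ : Ψ) (k : Fin Q) :
    Tendsto (fun L => rate Θ T N₀ (h L) (m L) (P L) ψ k - R L / numUsers Ψ Q) atTop (𝓝 0) := by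
  have hM' : (0 : ℝ) < M ψ k := by exact_mod_cast hM ψ k
  have h1 : Tendsto (fun L => csiFactor M Θ T * ∑ q, Real.log ((1 + P L ψ k q * g L ψ k q / N₀) /
      Real.exp (minRate Θ T N₀ (h L) (m L) (P L) / (csiFactor M Θ T * M ψ k)))) atTop (𝓝 0) := by
    have := (tendsto_finsetSum Finset.univ fun (q : Fin (M ψ k)) _ =>
      (hg.tendsto_sinr_ratio hQ hM hβ hN₀ hξ hP ψ k q).log one_ne_zero).const_mul (csiFactor M Θ T)
    simpa using this
  have h2 := h1.add (hg.tendsto_minRate hQ hM hβ hN₀ hPtot hξ hR hP).1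
  rw [add_zero] at h2
  refine h2.congr' ?_
  filter_upwards [hg.decoupled, hP] with L hdec hopt
  rw [hdec.rate_eq, Finset.sum_congr rfl fun q _ => Real.log_div
    (zero_lt_one.trans_le (hdec.one_le hN₀ (hopt.1.1 ψ k q))).ne' (Real.exp_pos _).ne']
  simp only [Real.log_exp, Finset.sum_sub_distrib, Finset.sum_const, Finset.card_univ,
    Fintype.card_fin, nsmul_eq_mul]
  field_simp
  ring

theorem HasAsymptoticGains.tendsto_sumRate (hg : HasAsymptoticGains Θ T N₀ β h m g κ)
    (hQ : 0 < Q) (hM : ∀ ψ k, 0 < M ψ k)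
    (hβ : ∀ ψ k, 0 < β ψ k) (hN₀ : 0 < N₀) (hPtot : 0 < Ptot) (hξ : 0 < csiFactor M Θ T)
    (hR : ∀ᶠ L : ℕ in atTop, SolvesExpEq Θ T N₀ Ptot M β L (R L))
    (hP : ∀ᶠ L : ℕ in atTop, IsMMFOptimal Θ T N₀ Ptot (h L) (m L) (P L)) :
    Tendsto (fun L => sumRate Θ T N₀ (h L) (m L) (P L) - R L) atTop (𝓝 0) := by
  have h1 := tendsto_finsetSum Finset.univ fun (ψ : Ψ) _ => tendsto_finsetSum Finset.univ
    fun (k : Fin Q) _ => hg.tendsto_rate hQ hM hβ hN₀ hPtot hξ hR hP ψ k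
  simp only [Finset.sum_const_zero] at h1
  refine h1.congr fun L => ?_
  have h2 : (Fintype.card Ψ : ℝ) * (Q * (R L / numUsers Ψ Q)) = R L := by
    rw [← mul_assoc]
    exact mul_div_cancel₀ _ (numUsers_pos Ψ hQ).ne'
  simp only [sumRate, Finset.sum_sub_distrib, Finset.sum_const, Finset.card_univ, Fintype.card_fin,
    nsmul_eq_mul]
  rw [h2]

theorem HasAsymptoticGains.isEquivalent_power (hg : HasAsymptoticGains Θ T N₀ β h m g κ)
    (hlim : ∀ ψ k q, Tendsto (fun L => g L ψ k q / detEig M β L ψ k) atTop (𝓝 1))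
    (hQ : 0 < Q) (hM : ∀ ψ k, 0 < M ψ k)
    (hβ : ∀ ψ k, 0 < β ψ k) (hN₀ : 0 < N₀) (hPtot : 0 < Ptot) (hξ : 0 < csiFactor M Θ T)
    (hR : ∀ᶠ L : ℕ in atTop, SolvesExpEq Θ T N₀ Ptot M β L (R L))
    (hP : ∀ᶠ L : ℕ in atTop, IsMMFOptimal Θ T N₀ Ptot (h L) (m L) (P L))
    (ψ : Ψ) (k : Fin Q) (q : Fin (M ψ k)) :
    Asymptotics.IsEquivalent atTop (fun L : ℕ => P L ψ k q)
      (fun L : ℕ => detPower Θ T N₀ M β L (R L) ψ k q) := by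
  have hM' : (0 : ℝ) < M ψ k := by exact_mod_cast hM ψ k
  have hN := numUsers_pos Ψ hQ
  have hne : ∀ᶠ L : ℕ in atTop, detPower Θ T N₀ M β L (R L) ψ k q ≠ 0 := by
    filter_upwards [eventually_solution_pos hQ hM hβ hN₀ hPtot hξ hR,
      eventually_detEig_pos (M := M) hβ] with L hpos hD
    exact (detPower_pos hM hQ hN₀ hξ hD hpos ψ k q).ne'
  rw [Asymptotics.isEquivalent_iff_tendsto_one hne]
  set r : ℕ → ℝ := fun L => R L / (csiFactor M Θ T * (M ψ k : ℝ) * numUsers Ψ Q) with hr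
  set t : ℕ → ℝ := fun L => minRate Θ T N₀ (h L) (m L) (P L) with ht
  have hrtop : Tendsto r atTop atTop :=
    (tendsto_solution_atTop hQ hM hβ hN₀ hPtot hξ hR).atTop_div_const (by positivity)
  have hinv : Tendsto (fun L => Real.exp (-r L)) atTop (𝓝 0) :=
    Real.tendsto_exp_atBot.comp (tendsto_neg_atTop_atBot.comp hrtop)
  have hquot : Tendsto (fun L => Real.exp (t L / (csiFactor M Θ T * M ψ k) - r L)) atTop
      (𝓝 1) := by
    have h1 := (hg.tendsto_minRate hQ hM hβ hN₀ hPtot hξ hR hP).1.div_const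
      (csiFactor M Θ T * M ψ k)
    rw [zero_div] at h1
    have h2 := (Real.continuous_exp.tendsto 0).comp h1
    rw [Real.exp_zero] at h2
    refine h2.congr fun L => ?_
    simp only [Function.comp, hr, ht]
    congr 1
    field_simp
  have hy := hg.tendsto_sinr_ratio hQ hM hβ hN₀ hξ hP ψ k q
  -- With `D = detEig`, minimum rate `t`, `x = exp (t / (ξ M))` and `y = (1 + SINR) / x`, the ratio
  -- of powers is `(D / g) (x y exp (-r) - exp (-r)) / (1 - exp (-r))`. Here `x exp (-r) → 1` needs
  -- the additive convergence of the minimum rate.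
  have hall := (((hlim ψ k q).inv₀ one_ne_zero).mul ((hquot.mul hy).sub hinv)).div
    (hinv.const_sub 1) (by norm_num)
  norm_num at hall
  refine hall.congr' ?_
  filter_upwards [hg.decoupled, eventually_detEig_pos (M := M) hβ, hne,
    eventually_solution_pos hQ hM hβ hN₀ hPtot hξ hR] with L hdec hD hL hpos
  have hgp := (hdec.pos ψ k q).ne'
  have hDp := (hD ψ k).ne'
  have hrpos : 0 < r L := div_pos hpos (by positivity)
  have hE : Real.exp (r L) - 1 ≠ 0 := by
    have := Real.one_lt_exp_iff.2 hrpos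
    linarith
  have hE0 := (Real.exp_pos (r L)).ne'
  have hX0 := (Real.exp_pos (t L / (csiFactor M Θ T * M ψ k))).ne'
  simp only [Pi.div_apply, detPower]
  change _ = P L ψ k q / (N₀ * (Real.exp (r L) - 1) / detEig M β L ψ k)
  rw [Real.exp_sub, Real.exp_neg]
  change detEig M β L ψ k / g L ψ k q * (Real.exp (t L / (csiFactor M Θ T * M ψ k)) /
    Real.exp (r L) * ((1 + P L ψ k q * g L ψ k q / N₀) /
    Real.exp (t L / (csiFactor M Θ T * M ψ k))) - (Real.exp (r L))⁻¹) /
    (1 - (Real.exp (r L))⁻¹) = _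
  generalize Real.exp (t L / (csiFactor M Θ T * M ψ k)) = x at *
  generalize Real.exp (r L) = e at *
  rw [show 1 - e⁻¹ = (e - 1) / e by field_simp]
  field_simp
  ring

end Asymptotics

end VCC

theorem lemma2 {Ψ : Type*} [Fintype Ψ] [Nonempty Ψ] {Q : ℕ} (hQ : 0 < Q)
    (M : Ψ → Fin Q → ℕ) (hM : ∀ ψ k, 0 < M ψ k)
    (β : Ψ → Fin Q → ℝ) (hβ : ∀ ψ k, 0 < β ψ k)
    (N₀ Ptot Θ T : ℝ) (hN₀ : 0 < N₀) (hPtot : 0 < Ptot) (hΘ : 0 ≤ Θ) (hT : 0 < T)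
    (hξ : 0 < VCC.csiFactor M Θ T)
    {Ω : Type*} [MeasurableSpace Ω] (μ : Measure Ω) [IsProbabilityMeasure μ]
    (H : ∀ L : ℕ, Ω → VCC.Channel L M)
    (hH : ∀ L : ℕ, VCC.IsRayleigh μ β (H L)) :
    -- the exponential-sum equation determines a unique `R`, explicit for equal antenna numbers
    (∀ L : ℕ, (∀ ψ k, VCC.groupAntennas M ψ < L + M ψ k) →
      (∃! R : ℝ, VCC.SolvesExpEq Θ T N₀ Ptot M β L R) ∧
      ∀ M₀ : ℕ, (∀ ψ k, M ψ k = M₀) →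
        VCC.SolvesExpEq Θ T N₀ Ptot M β L (VCC.closedForm Θ T N₀ Ptot M β M₀ L)) ∧
    ∀ᵐ ω ∂μ,
      -- the eigenvalues
      (∀ ψ k q, Tendsto (fun L : ℕ => VCC.eigval (H L ω) ψ k q / VCC.detEig M β L ψ k)
        atTop (𝓝 1)) ∧
      -- full rank, so that BD-MRC with `M ψ k` streams for every user exists
      (∀ᶠ L : ℕ in atTop, (∀ ψ k, (VCC.effGram (H L ω) ψ k).rank = M ψ k) ∧
        ∃ m : VCC.Directions L M, VCC.IsDesign (H L ω) m) ∧
      ∀ m : (∀ L : ℕ, VCC.Directions L M), (∀ᶠ L : ℕ in atTop, VCC.IsDesign (H L ω) (m L)) →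
      ∀ R : ℕ → ℝ, (∀ᶠ L : ℕ in atTop, VCC.SolvesExpEq Θ T N₀ Ptot M β L (R L)) →
        -- the max-min fairness problem has a solution
        (∀ᶠ L : ℕ in atTop, ∃ P : VCC.Powers M,
          VCC.IsMMFOptimal Θ T N₀ Ptot (H L ω) (m L) P) ∧
        -- the explicit allocation is feasible, uses the whole power budget
        (∀ᶠ L : ℕ in atTop, VCC.Feasible Ptot (VCC.detPower Θ T N₀ M β L (R L)) ∧
          VCC.totalPower (VCC.detPower Θ T N₀ M β L (R L)) = Ptot) ∧
        -- and gives every user asymptotically the rate `R / (G Q)`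
        (∀ ψ k, Tendsto (fun L : ℕ =>
          VCC.rate Θ T N₀ (H L ω) (m L) (VCC.detPower Θ T N₀ M β L (R L)) ψ k
            - R L / VCC.numUsers Ψ Q) atTop (𝓝 0)) ∧
        ∀ P : ℕ → VCC.Powers M,
          (∀ᶠ L : ℕ in atTop, VCC.IsMMFOptimal Θ T N₀ Ptot (H L ω) (m L) (P L)) →
          -- the optimal sum-rate is asymptotically `R`
          Tendsto (fun L : ℕ => VCC.sumRate Θ T N₀ (H L ω) (m L) (P L) - R L) atTop (𝓝 0) ∧
          Asymptotics.IsEquivalent atTop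
            (fun L : ℕ => VCC.sumRate Θ T N₀ (H L ω) (m L) (P L)) R ∧
          -- the explicit allocation is asymptotically optimal
          Tendsto (fun L : ℕ => VCC.minRate Θ T N₀ (H L ω) (m L) (P L)
            - VCC.minRate Θ T N₀ (H L ω) (m L) (VCC.detPower Θ T N₀ M β L (R L)))
            atTop (𝓝 0) ∧
          -- the optimal powers are asymptotically the explicit ones
          (∀ ψ k q, Asymptotics.IsEquivalent atTop (fun L : ℕ => P L ψ k q)
            (fun L : ℕ => VCC.detPower Θ T N₀ M β L (R L) ψ k q)) ∧
          -- the closed form for equal antenna numbers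
          (∀ M₀ : ℕ, (∀ ψ k, M ψ k = M₀) →
            Tendsto (fun L : ℕ => VCC.sumRate Θ T N₀ (H L ω) (m L) (P L)
              - VCC.closedForm Θ T N₀ Ptot M β M₀ L) atTop (𝓝 0) ∧
            Asymptotics.IsEquivalent atTop
              (fun L : ℕ => VCC.sumRate Θ T N₀ (H L ω) (m L) (P L))
              (fun L : ℕ => VCC.closedForm Θ T N₀ Ptot M β M₀ L)) := by
  refine ⟨fun L hL => ?_, ?_⟩
  · have hD : ∀ ψ k, 0 < VCC.detEig M β L ψ k := fun ψ k => VCC.detEig_pos hβ (hL ψ k)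
    exact ⟨VCC.existsUnique_solvesExpEq hQ hM hN₀ hPtot hξ hD, fun M₀ hM₀ =>
      VCC.solvesExpEq_closedForm hQ hM hβ hN₀ hPtot hξ hD hM₀⟩
  -- This is the only exceptional null set, chosen before the designs and allocations, so the
  -- conclusion holds for every choice of them.
  filter_upwards [VCC.ae_gramConverges hβ hH] with ω hω
  have hunit : ∀ᶠ L : ℕ in atTop, ∀ ψ k, IsUnit (VCC.othersGram (H L ω) ψ k).det :=
    eventually_all.2 fun ψ => eventually_all.2 fun k => (hω.tendsto_effGram hβ ψ k).1
  have hDpos := VCC.eventually_detEig_pos (M := M) hβ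
  have heig : ∀ ψ k q, Tendsto (fun L : ℕ => VCC.eigval (H L ω) ψ k q / VCC.detEig M β L ψ k)
      atTop (𝓝 1) := fun ψ k q => hω.tendsto_eigenvalue hβ ψ k
    (Eventually.of_forall fun L => VCC.exists_eigvec_eigval (H L ω) ψ k q)
  have heig0 : ∀ᶠ L : ℕ in atTop, ∀ ψ k q, VCC.eigval (H L ω) ψ k q ≠ 0 :=
    eventually_all.2 fun ψ => eventually_all.2 fun k => eventually_all.2 fun q => by
      filter_upwards [(heig ψ k q).eventually_ne one_ne_zero] with L hL h0
      exact hL (by rw [h0, zero_div])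
  refine ⟨heig, ?_, fun m hm R hR => ?_⟩
  · filter_upwards [hunit, heig0] with L hu h0
    exact ⟨fun ψ k => VCC.rank_effGram_of_eigval_ne_zero (h0 ψ k), VCC.exists_isDesign hu h0⟩
  set g : ℕ → VCC.Powers M := fun L ψ k q => VCC.gain (H L ω) (m L) ψ k q k q with hgdef
  have hdec : ∀ᶠ L : ℕ in atTop, VCC.Decoupled Θ T N₀ (H L ω) (m L) (g L) := by
    filter_upwards [hunit, hm] with L hu hL
    exact VCC.decoupled_of_isDesign hu hL Θ T N₀
  have hlim : ∀ ψ k q, Tendsto (fun L => g L ψ k q / VCC.detEig M β L ψ k) atTop (𝓝 1) :=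
    fun ψ k q => hω.tendsto_eigenvalue hβ ψ k (by
      filter_upwards [hunit, hm] with L hu hL
      exact (VCC.gain_of_isDesign hu hL ψ k q).2.2.2)
  obtain ⟨κ, hκ1, hκ⟩ := VCC.exists_gainsClose hβ (hdec.mono fun L hL => hL.pos) hlim
  have hg : VCC.HasAsymptoticGains Θ T N₀ β (fun L => H L ω) m g κ := ⟨hdec, hκ, hκ1⟩
  have hRtop := VCC.tendsto_solution_atTop hQ hM hβ hN₀ hPtot hξ hR
  refine ⟨hdec.mono fun L hL => hL.exists_isMMFOptimal hQ hN₀ hPtot.le,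
    VCC.eventually_feasible_detPower hQ hM hβ hN₀ hPtot hξ hR,
    hg.tendsto_rate_detPower hQ hM hβ hN₀ hPtot hξ hR, fun P hP => ?_⟩
  have hsum := hg.tendsto_sumRate hQ hM hβ hN₀ hPtot hξ hR hP
  have hequiv : Asymptotics.IsEquivalent atTop
      (fun L : ℕ => VCC.sumRate Θ T N₀ (H L ω) (m L) (P L)) R := by
    -- Since `R → ∞`, an error that is `o(1)` is also `o(R)`.
    have h1 : (fun _ : ℕ => (1 : ℝ)) =O[atTop] R :=
      Asymptotics.isBigO_iff.2 ⟨1, by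
        filter_upwards [hRtop.eventually_ge_atTop 1] with L hL
        simpa using hL.trans (le_abs_self _)⟩
    exact ((Asymptotics.isLittleO_one_iff ℝ).2 hsum).trans_isBigO h1
  refine ⟨hsum, hequiv, (hg.tendsto_minRate hQ hM hβ hN₀ hPtot hξ hR hP).2,
    hg.isEquivalent_power hlim hQ hM hβ hN₀ hPtot hξ hR hP, fun M₀ hM₀ => ?_⟩
  have hclosed : R =ᶠ[atTop] fun L : ℕ => VCC.closedForm Θ T N₀ Ptot M β M₀ L := by
    filter_upwards [hR, hDpos] with L hL hD
    exact (VCC.existsUnique_solvesExpEq hQ hM hN₀ hPtot hξ hD).unique hL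
      (VCC.solvesExpEq_closedForm hQ hM hβ hN₀ hPtot hξ hD hM₀)
  refine ⟨hsum.congr' ?_, hequiv.congr_right hclosed⟩
  filter_upwards [hclosed] with L hL
  rw [hL]
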